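/- Let $\lambda,\mu\in(0,1]$, $\beta\in(0,1)$, $p=\lambda\mu$ and $q=1-p$. Consider the controlled Markov chain on states $(b,i)\in\{0,1\}\times\{1,2,3,\dots\}$, where $i$ is the age of information (AoI) of a user at the beginning of a time slot and $b=1$ iff a packet has just been generated. In a state $(1,i)$ one chooses $a=1$ (attempt to transmit) or $a=0$ (do not); in a state $(0,i)$ only $a=0$ is available. In the next slot $b'=1$ with probability $\lambda$, independently of the past and of whether transmissions succeed; if $a=1$ then, with probability $\mu$, the next AoI is $1$; in all other cases it is $i+1$. Let $c_i\ge 0$ be a nondecreasing cost function on $\{1,2,\dots\}$ with $\sum_{i\ge1}c_iq^i<\infty$. With $X(t)$ and $A(t)$ the AoI and the action in slot $t$, put, for a policy $\pi$ and an initial state $(b,i)$, $$F^\pi_{(b,i)}=\mathbb E^\pi_{(b,i)}\Big[\sum_{t\ge0}\beta^tc_{X(t)}\Big]\in[0,\infty],\qquad G^\pi_{(b,i)}=\mathbb E^\pi_{(b,i)}\Big[\sum_{t\ge0}\beta^tA(t)\Big].$$ For a charge $\nu\in\mathbb R$, the single-user subproblem is to minimize $F^\pi_{(b,i)}+\nu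 G^\pi_{(b,i)}$ over all stationary (possibly randomized) policies $\pi$; a policy is called optimal if it is a minimizer for every initial state $(b,i)$. An action $a$ is called optimal in $(1,j)$ if some optimal policy takes it there with probability one. A Whittle index is a function $\nu^*_{(1,j)}\in\mathbb R$, $j\ge1$, such that for all $j\ge 1$ and all $\nu\in\mathbb R$: transmitting is optimal in $(1,j)$ if and only if $\nu\le\nu^*_{(1,j)}$, and not transmitting is optimal in $(1,j)$ if and only if $\nu^*_{(1,j)}\le\nu$. The model is indexable if it has a Whittle index. For $k\in\{0,1,2,\dots\}\cup\{\infty\}$, the $k$-threshold policy transmits in $(1,j)$ if and only if $j>k$. The model is threshold-indexable if it is indexable and, for every $\nu\in\mathbb R$, the $k$-threshold policy is optimal for some $k\in\{0,1,2,\dots\}\cup\{\infty\}$. For finite $k$ let $\langle a,k\rangle$ be the policy that takes action $a$ in slot $0$ and follows the $k$-threshold policy from slot $1$ onward, and for $i\ge1$ put $$f^k_{(1,i)}=F^{\langle0,k\rangle}_{(1,i)}-F^{\langle1,k\rangle}_{(1,i)},\qquad g^k_{(1,i)}=G^{\langle1,k\rangle}_{(1,i)}-G^{\langle0,k\rangle}_{(1,i)},\qquad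 m_{(1,i)}=\frac{f^i_{(1,i)}}{g^i_{(1,i)}};$$ $m_{(1,i)}$ is the marginal productivity (MP) index. Then: 1. for all $i\ge1$, $k\ge0$ and $a\in\{0,1\}$, $F^{\langle a,k\rangle}_{(1,i)}$ and $G^{\langle a,k\rangle}_{(1,i)}$ are finite, and $g^k_{(1,i)}>1-\beta$ (so the MP index is well defined); 2. $m_{(1,i)}$ is nondecreasing in $i$; 3. the model is threshold-indexable, and its Whittle index is the MP index, $\nu^*_{(1,i)}=m_{(1,i)}$; 4. for every $i\ge1$, $$m_{(1,i)}=\mu\left[\frac{\beta(1-\beta^i)(1-\beta q)}{1-\beta}\,C_{i+1}(q)-\sum_{j=1}^i\beta^jc_j\right],\qquad C_{i+1}(q)=\sum_{j=1}^\infty(\beta q)^{j-1}c_{i+j},$$ where the series converges and, for $q=0$, is read as $C_{i+1}(0)=c_{i+1}$. -/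

import Mathlib

open MeasureTheory ProbabilityTheory
open scoped ENNReal unitInterval

noncomputable section

namespace AoI

instance : MeasurableSpace ℕ+ := ⊤

instance : DiscreteMeasurableSpace ℕ+ := ⟨fun _ => trivial⟩

/-- A user's state `(b, i)`: `b = true` iff a packet has just been generated, and `i ≥ 1` is
the age of information (AoI) at the beginning of the slot. -/
abbrev State : Type := Bool × ℕ+

/-- What is observed in one slot: the state `Y(t)` and the action `A(t)`
(`true` is an attempt to transmit). -/
abbrev Slot : Type := State × Bool

/-- The law of a coin that shows `true` with probability `p`. -/
def coin (p : I) : PMF Bool :=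
  PMF.ofFintype (fun b => ENNReal.ofReal (if b then (p : ℝ) else 1 - p)) (by
    rw [Fintype.sum_bool, if_pos rfl, if_neg Bool.false_ne_true,
      ← ENNReal.ofReal_add p.2.1 (sub_nonneg.2 p.2.2)]
    simp)

/-- One-slot transition law from state `y` under action `a`. A new packet arrives with
probability `lam`, and independently the channel is up with probability `mu`; the AoI drops
to `1` if a packet was available, its transmission was attempted and the channel was up, and
grows by one otherwise. -/
def nextState (lam mu : I) (y : State) (a : Bool) : PMF State :=
  (coin lam).bind fun b' => (coin mu).bind fun up =>
    PMF.pure (b', if y.1 && a && up then 1 else y.2 + 1)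

/-- A Markov policy: `π t i` is the probability of attempting to transmit in slot `t` when the
state is `(1, i)`. In the uncontrollable states `(0, i)` no transmission can be attempted. -/
abbrev Policy : Type := ℕ → ℕ+ → I

/-- A stationary (possibly randomized) policy: `π i` is the probability of attempting to
transmit in state `(1, i)`, whatever the slot. -/
abbrev StationaryPolicy : Type := ℕ+ → I

/-- A stationary policy as a Markov policy. -/
def StationaryPolicy.toPolicy (π : StationaryPolicy) : Policy := fun _ => π

/-- The law of the action taken in slot `t` and state `y`. -/
def actionLaw (π : Policy) (t : ℕ) (y : State) : PMF Bool :=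
  if y.1 then coin (π t y.2) else PMF.pure false

/-- The joint law of state and action in slot `t`, given that the state is `y`. -/
def slotLaw (π : Policy) (t : ℕ) (y : State) : PMF Slot :=
  (actionLaw π t y).map fun a => (y, a)

/-- The law of slot `t + 1` given slot `t`. -/
def stepLaw (lam mu : I) (π : Policy) (t : ℕ) (s : Slot) : PMF Slot :=
  (nextState lam mu s.1 s.2).bind (slotLaw π (t + 1))

/-- The kernel giving the law of slot `t + 1` given the history of slots `0, …, t`. -/
def stepKernel (lam mu : I) (π : Policy) (t : ℕ) :
    Kernel ((n : Finset.Iic t) → (fun _ : ℕ => Slot) n) Slot :=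
  Kernel.comap (Kernel.ofFunOfCountable fun s : Slot => (stepLaw lam mu π t s).toMeasure)
    (fun h => h ⟨t, Finset.mem_Iic.2 le_rfl⟩) (measurable_pi_apply _)

instance (lam mu : I) (π : Policy) (t : ℕ) : IsMarkovKernel (stepKernel lam mu π t) := by
  refine ⟨fun h => ?_⟩
  rw [stepKernel, Kernel.comap_apply]
  exact PMF.toMeasure.isProbabilityMeasure _

/-- The law `P^π_y` of the trajectory `(Y(t), A(t))`, `t = 0, 1, …`, under policy `π`,
started from `Y(0) = y`. -/
def trajLaw (lam mu : I) (π : Policy) (y : State) : Measure (ℕ → Slot) :=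
  Kernel.trajMeasure (X := fun _ => Slot) (slotLaw π 0 y).toMeasure (stepKernel lam mu π)

/-- The cost metric `F^π_y = E^π_y [∑ t, β ^ t * c (X(t))]`, which may be infinite. -/
def costMetric (lam mu : I) (β : ℝ) (c : ℕ+ → ℝ) (π : Policy) (y : State) : ℝ≥0∞ :=
  ∫⁻ ω, ∑' t, ENNReal.ofReal (β ^ t * c (ω t).1.2) ∂(trajLaw lam mu π y)

/-- The work metric `G^π_y = E^π_y [∑ t, β ^ t * A(t)]`. -/
def workMetric (lam mu : I) (β : ℝ) (π : Policy) (y : State) : ℝ≥0∞ :=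
  ∫⁻ ω, ∑' t, ENNReal.ofReal (β ^ t * (if (ω t).2 then 1 else 0)) ∂(trajLaw lam mu π y)

/-- The objective `F^π_y + ν G^π_y` of the single-user subproblem with transmission charge
`ν`. -/
def objective (lam mu : I) (β : ℝ) (c : ℕ+ → ℝ) (ν : ℝ) (π : Policy) (y : State) : EReal :=
  (costMetric lam mu β c π y : EReal) + (ν : EReal) * (workMetric lam mu β π y : EReal)

/-- The stationary policy `π` solves the single-user subproblem with charge `ν` over all
stationary policies, for every initial state. -/
def IsOptimal (lam mu : I) (β : ℝ) (c : ℕ+ → ℝ) (ν : ℝ) (π : StationaryPolicy) : Prop :=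
  ∀ (π' : StationaryPolicy) (y : State),
    objective lam mu β c ν π.toPolicy y ≤ objective lam mu β c ν π'.toPolicy y

/-- The probability of transmitting that takes action `a` for sure. -/
def sure (a : Bool) : I := if a then 1 else 0

/-- Taking action `a` in state `(1, j)` is optimal under charge `ν`: some policy which is
optimal for every initial state takes action `a` there. -/
def IsOptimalAction (lam mu : I) (β : ℝ) (c : ℕ+ → ℝ) (ν : ℝ) (j : ℕ+) (a : Bool) : Prop :=
  ∃ π : StationaryPolicy, IsOptimal lam mu β c ν π ∧ π j = sure a

/-- `idx` is the Whittle index: under every charge `ν`, transmitting in `(1, j)` is optimal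
iff `ν ≤ idx j`, and not transmitting in `(1, j)` is optimal iff `idx j ≤ ν`. -/
def IsWhittleIndex (lam mu : I) (β : ℝ) (c : ℕ+ → ℝ) (idx : ℕ+ → ℝ) : Prop :=
  ∀ (j : ℕ+) (ν : ℝ),
    (IsOptimalAction lam mu β c ν j true ↔ ν ≤ idx j) ∧
    (IsOptimalAction lam mu β c ν j false ↔ idx j ≤ ν)

/-- The model is indexable: it possesses a Whittle index. -/
def Indexable (lam mu : I) (β : ℝ) (c : ℕ+ → ℝ) : Prop :=
  ∃ idx : ℕ+ → ℝ, IsWhittleIndex lam mu β c idx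

open Classical in
/-- The `k`-policy: transmit in `(1, j)` iff `j > k`. For `k = ⊤` it never transmits. -/
def threshold (k : ℕ∞) : StationaryPolicy := fun j => sure (decide (k < ((j : ℕ) : ℕ∞)))

/-- Threshold-indexability: indexability, and for every charge some threshold policy is
optimal for every initial state. -/
def ThresholdIndexable (lam mu : I) (β : ℝ) (c : ℕ+ → ℝ) : Prop :=
  Indexable lam mu β c ∧ ∀ ν : ℝ, ∃ k : ℕ∞, IsOptimal lam mu β c ν (threshold k)

/-- The policy `⟨a, k⟩`: action `a` in slot `0`, the `k`-policy from slot `1` onward. -/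
def firstThen (a : Bool) (k : ℕ) : Policy :=
  fun t j => if t = 0 then sure a else threshold k j

/-- The marginal cost metric of the `k`-policy in state `(1, i)`. -/
def marginalCost (lam mu : I) (β : ℝ) (c : ℕ+ → ℝ) (k : ℕ) (i : ℕ+) : ℝ :=
  (costMetric lam mu β c (firstThen false k) (true, i)).toReal -
    (costMetric lam mu β c (firstThen true k) (true, i)).toReal

/-- The marginal work metric of the `k`-policy in state `(1, i)`. -/
def marginalWork (lam mu : I) (β : ℝ) (k : ℕ) (i : ℕ+) : ℝ :=
  (workMetric lam mu β (firstThen true k) (true, i)).toReal -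
    (workMetric lam mu β (firstThen false k) (true, i)).toReal

/-- The marginal productivity (MP) index of state `(1, i)`. -/
def mpIndex (lam mu : I) (β : ℝ) (c : ℕ+ → ℝ) (i : ℕ+) : ℝ :=
  marginalCost lam mu β c i i / marginalWork lam mu β i i

/-- `C_i(q) = ∑_{j ≥ 1} (β q) ^ (j - 1) * c (i - 1 + j)`, with `j - 1` as summation index.
For `q = 0` it equals `c i`. -/
def tailCost (β : ℝ) (c : ℕ+ → ℝ) (q : ℝ) (i : ℕ+) : ℝ :=
  ∑' j : ℕ, (β * q) ^ j * c ⟨i + j, Nat.add_pos_left i.pos j⟩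

end AoI

end

/-! Arrivals are i.i.d., so averaging a value over the arrival indicator leaves a function `W` of
the age alone. With `p = lam * mu`, a stationary policy `π` satisfies `W i = c i + β W (i+1) - lam
π_i A i`, where `A i = β mu (W (i+1) - W 1) - ν` is the `advantage` of transmitting.

For the `k`-threshold policy this is solvable. Below the threshold the recursion telescopes down to
age `1`; beyond it, `W` is the tail cost plus a constant (`thresholdValue`). Eliminating the
unknowns shows that, at `i = k` and at `i = k + 1`, `A i` times a positive weight equals `(1 - β)`
times the closed-form index minus `ν` (`advantage_at`, `advantage_succ`). If the index at `k` is at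
most `ν`, then `W` is nondecreasing, hence so is `A`; so when `ν` lies between the index values at
`k` and `k + 1`, the sign of `A` favours the threshold action in every state. Such a policy is
`Certified`. It beats every stationary policy by a discounted comparison, which tolerates unbounded
costs because the tail cost bounds every policy's mean cost from below. Conversely, an optimal
policy has the same value and can deviate from a certified one only where `A` vanishes. As the
closed form is nondecreasing (`Params.index_mono`), a suitable `k` exists whenever some index value
is at least `ν`. Otherwise costs are bounded and never transmitting is certified, by a separate
argument. Strict versions of the sign statements give both equivalences of the Whittle index.

For a fixed threshold policy `A` is affine in `ν`, namely marginal cost minus `ν` times marginal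
work. Comparing `ν = 0` with `ν = 1` in `advantage_at` therefore identifies the MP index with the
closed form (`mpIndex_eq`). -/

noncomputable section

namespace AoI

/-! ### Expectations under a discrete law -/

/-- The expectation of `g` under the discrete law `p`. -/
def expect {α : Type*} (p : PMF α) (g : α → ℝ≥0∞) : ℝ≥0∞ := ∑' a, p a * g a

section Expect

variable {α γ : Type*}

lemma expect_pure (a : α) (g : α → ℝ≥0∞) : expect (PMF.pure a) g = g a := by
  classical
  rw [expect, tsum_eq_single a]
  · simp
  · intro b hb
    simp [PMF.pure_apply_of_ne _ _ hb]

lemma expect_bind (p : PMF α) (f : α → PMF γ) (g : γ → ℝ≥0∞) :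
    expect (p.bind f) g = expect p fun a => expect (f a) g := by
  simp only [expect, PMF.bind_apply, ← ENNReal.tsum_mul_right, ← ENNReal.tsum_mul_left]
  rw [ENNReal.tsum_comm]
  simp only [mul_assoc]

lemma expect_map (p : PMF α) (f : α → γ) (g : γ → ℝ≥0∞) :
    expect (p.map f) g = expect p fun a => g (f a) := by
  rw [PMF.map, expect_bind]
  simp only [Function.comp_apply, expect_pure]

lemma expect_coin (p : I) (g : Bool → ℝ≥0∞) :
    expect (coin p) g =
      ENNReal.ofReal p * g true + ENNReal.ofReal (1 - p) * g false := by
  simp [expect, coin]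

lemma expect_mono (p : PMF α) {g h : α → ℝ≥0∞} (hgh : ∀ a, g a ≤ h a) :
    expect p g ≤ expect p h :=
  ENNReal.tsum_le_tsum fun a => mul_le_mul_right (hgh a) _

lemma expect_add (p : PMF α) (g h : α → ℝ≥0∞) :
    expect p (fun a => g a + h a) = expect p g + expect p h := by
  simp only [expect, mul_add, ENNReal.tsum_add]

lemma expect_const_mul (p : PMF α) (b : ℝ≥0∞) (g : α → ℝ≥0∞) :
    expect p (fun a => b * g a) = b * expect p g := by
  simp only [expect, ← ENNReal.tsum_mul_left, mul_left_comm]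

lemma expect_const (p : PMF α) (b : ℝ≥0∞) : expect p (fun _ => b) = b := by
  simp only [expect, ENNReal.tsum_mul_right, PMF.tsum_coe, one_mul]

lemma expect_tsum (p : PMF α) (g : ℕ → α → ℝ≥0∞) :
    expect p (fun a => ∑' t, g t a) = ∑' t, expect p (g t) := by
  simp only [expect, ← ENNReal.tsum_mul_left]
  rw [ENNReal.tsum_comm]

lemma lintegral_toMeasure [MeasurableSpace α] [Countable α] [MeasurableSingletonClass α]
    (p : PMF α) (g : α → ℝ≥0∞) : ∫⁻ a, g a ∂p.toMeasure = expect p g := by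
  rw [lintegral_countable']
  simp only [expect, PMF.toMeasure_apply_singleton _ _ (measurableSet_singleton _), mul_comm]

end Expect

/-! ### The law of a slot -/

/-- The policy seen from slot `1` onward. -/
def Policy.shift (π : Policy) : Policy := fun t => π (t + 1)

/-- The law of slot `t` under policy `π` from initial state `y`. -/
def slotLawAt (lam mu : I) (π : Policy) (y : State) : ℕ → PMF Slot
  | 0 => slotLaw π 0 y
  | t + 1 => (slotLawAt lam mu π y t).bind (stepLaw lam mu π t)

/-- The definition appends slots at the end, whereas dynamic programming peels off the first slot;
the two agree by associativity of `bind`. -/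
lemma slotLawAt_succ_eq_shift (lam mu : I) (π : Policy) (y : State) (t : ℕ) :
    slotLawAt lam mu π y (t + 1) = (slotLaw π 0 y).bind fun s =>
      (nextState lam mu s.1 s.2).bind fun y' => slotLawAt lam mu π.shift y' t := by
  induction t with
  | zero => rfl
  | succ t ih =>
    rw [slotLawAt, ih, PMF.bind_bind]
    simp only [PMF.bind_bind]
    rfl

instance (lam mu : I) (π : Policy) (y : State) : IsProbabilityMeasure (trajLaw lam mu π y) := by
  have : IsProbabilityMeasure (slotLaw π 0 y).toMeasure := PMF.toMeasure.isProbabilityMeasure _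
  unfold trajLaw
  infer_instance

/-- The bridge from the trajectory measure to discrete laws: after this, only one-slot marginals are
needed, since the metrics are sums over slots. -/
lemma lintegral_trajLaw (lam mu : I) (π : Policy) (y : State) (t : ℕ) (g : Slot → ℝ≥0∞) :
    ∫⁻ ω, g (ω t) ∂(trajLaw lam mu π y) = expect (slotLawAt lam mu π y t) g := by
  have : IsProbabilityMeasure (slotLaw π 0 y).toMeasure := PMF.toMeasure.isProbabilityMeasure _
  induction t generalizing g with
  | zero =>
    have hg : Measurable g := .of_discrete
    rw [slotLawAt, ← lintegral_toMeasure]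
    have h0 : (trajLaw lam mu π y).map (Preorder.frestrictLe (π := fun _ : ℕ => Slot) 0) =
        ((slotLaw π 0 y).toMeasure).map
          (MeasurableEquiv.piUnique (fun _ : Finset.Iic 0 => Slot)).symm := by
      rw [trajLaw, Kernel.trajMeasure, Measure.map_comp _ _ (by fun_prop),
        Kernel.traj_map_frestrictLe, Kernel.partialTraj_self, Measure.id_comp]
    have h1 : ∫⁻ ω, g (ω 0) ∂(trajLaw lam mu π y) =
        ∫⁻ h, g (h ⟨0, Finset.mem_Iic.2 le_rfl⟩) ∂((trajLaw lam mu π y).map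
          (Preorder.frestrictLe (π := fun _ : ℕ => Slot) 0)) :=
      (lintegral_map (f := fun h : Finset.Iic 0 → Slot => g (h ⟨0, Finset.mem_Iic.2 le_rfl⟩))
        (g := Preorder.frestrictLe (π := fun _ : ℕ => Slot) 0) (by fun_prop) (by fun_prop)).symm
    rw [h1, h0, lintegral_map (by fun_prop) (by fun_prop)]
    rfl
  | succ t ih =>
    rw [slotLawAt, expect_bind, ← ih]
    -- The joint law of the history up to `t` and slot `t + 1` is the history law composed with
    -- `stepKernel`, which only reads slot `t`.
    have hκ := Kernel.map_frestrictLe_trajMeasure_compProd_eq_map_trajMeasure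
      (X := fun _ : ℕ => Slot) (κ := stepKernel lam mu π) (μ₀ := (slotLaw π 0 y).toMeasure)
      (a := t)
    have hg : Measurable g := .of_discrete
    have h1 : ∫⁻ ω, g (ω (t + 1)) ∂(trajLaw lam mu π y) =
        ∫⁻ z, g z.2 ∂((trajLaw lam mu π y).map
          (fun x => (Preorder.frestrictLe (π := fun _ : ℕ => Slot) t x, x (t + 1)))) :=
      (lintegral_map (f := fun z : (Finset.Iic t → Slot) × Slot => g z.2)
        (g := fun x => (Preorder.frestrictLe (π := fun _ : ℕ => Slot) t x, x (t + 1)))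
        (by fun_prop) (by fun_prop)).symm
    have hg2 : Measurable fun z : (Finset.Iic t → Slot) × Slot => g z.2 := by fun_prop
    rw [h1, trajLaw, ← hκ, Measure.lintegral_compProd hg2,
      lintegral_map hg2.lintegral_kernel_prod_right (by fun_prop)]
    refine lintegral_congr fun ω => ?_
    rw [← lintegral_toMeasure]
    rfl

/-! ### Discounted metrics and their one-step recursion -/

/-- The total expected reward `∑ t, b ^ t * E[r (Y(t), A(t))]`. -/
def metric (lam mu : I) (b : ℝ≥0∞) (r : Slot → ℝ≥0∞) (π : Policy) (y : State) : ℝ≥0∞ :=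
  ∑' t, b ^ t * expect (slotLawAt lam mu π y t) r

/-- The reward collected in the first `n` slots. -/
def metricUpTo (lam mu : I) (b : ℝ≥0∞) (r : Slot → ℝ≥0∞) (n : ℕ) (π : Policy) (y : State) :
    ℝ≥0∞ :=
  ∑ t ∈ Finset.range n, b ^ t * expect (slotLawAt lam mu π y t) r

/-- The mean of `u` over the arrival indicator. -/
def arrivalMean (lam : I) (u : State → ℝ≥0∞) (i : ℕ+) : ℝ≥0∞ :=
  ENNReal.ofReal lam * u (true, i) + ENNReal.ofReal (1 - lam) * u (false, i)

lemma costMetric_eq_metric (lam mu : I) {β : ℝ} (hβ : 0 ≤ β) (c : ℕ+ → ℝ) (π : Policy)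
    (y : State) :
    costMetric lam mu β c π y =
      metric lam mu (ENNReal.ofReal β) (fun s => ENNReal.ofReal (c s.1.2)) π y := by
  have hm : ∀ t, Measurable fun ω : ℕ → Slot => ENNReal.ofReal (β ^ t * c (ω t).1.2) := fun t =>
    (Measurable.of_discrete (f := fun s : Slot => ENNReal.ofReal (β ^ t * c s.1.2))).comp
      (measurable_pi_apply t)
  rw [costMetric, lintegral_tsum fun t => (hm t).aemeasurable]
  refine tsum_congr fun t => ?_
  rw [lintegral_trajLaw lam mu π y t fun s => ENNReal.ofReal (β ^ t * c s.1.2),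
    ← expect_const_mul]
  simp only [ENNReal.ofReal_mul (pow_nonneg hβ t), ENNReal.ofReal_pow hβ]

lemma workMetric_eq_metric (lam mu : I) {β : ℝ} (hβ : 0 ≤ β) (π : Policy) (y : State) :
    workMetric lam mu β π y =
      metric lam mu (ENNReal.ofReal β) (fun s => if s.2 then 1 else 0) π y := by
  have hm : ∀ t, Measurable fun ω : ℕ → Slot =>
      ENNReal.ofReal (β ^ t * (if (ω t).2 then 1 else 0)) := fun t =>
    (Measurable.of_discrete (f := fun s : Slot =>
      ENNReal.ofReal (β ^ t * (if s.2 then 1 else 0)))).comp (measurable_pi_apply t)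
  rw [workMetric, lintegral_tsum fun t => (hm t).aemeasurable]
  refine tsum_congr fun t => ?_
  rw [lintegral_trajLaw lam mu π y t fun s => ENNReal.ofReal (β ^ t * (if s.2 then 1 else 0)),
    ← expect_const_mul]
  congr 1
  funext s
  rw [ENNReal.ofReal_mul (pow_nonneg hβ t), ENNReal.ofReal_pow hβ]
  split_ifs <;> simp

lemma expect_nextState (lam mu : I) (y : State) (a : Bool) (u : State → ℝ≥0∞) :
    expect (nextState lam mu y a) u =
      ENNReal.ofReal mu * arrivalMean lam u (if y.1 && a then 1 else y.2 + 1) +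
        ENNReal.ofReal (1 - mu) * arrivalMean lam u (y.2 + 1) := by
  simp only [nextState, expect_bind, expect_pure, expect_coin, arrivalMean]
  simp only [Bool.and_true, Bool.and_false, Bool.false_eq_true, if_false]
  ring

lemma ofReal_add_ofReal_one_sub (p : I) :
    ENNReal.ofReal p + ENNReal.ofReal (1 - p) = 1 := by
  rw [← ENNReal.ofReal_add p.2.1 (sub_nonneg.2 p.2.2)]
  simp

lemma metric_eq_expect (lam mu : I) (b : ℝ≥0∞) (r : Slot → ℝ≥0∞) (π : Policy) (y : State) :
    metric lam mu b r π y = expect (slotLaw π 0 y) fun s =>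
      r s + b * expect (nextState lam mu s.1 s.2) (metric lam mu b r π.shift) := by
  rw [metric, tsum_eq_zero_add' ENNReal.summable, expect_add, pow_zero, one_mul,
    expect_const_mul]
  simp only [slotLawAt_succ_eq_shift, expect_bind]
  change _ + _ = _ + b * expect _ fun s => expect _ fun y' => ∑' t, _
  simp only [expect_tsum, expect_const_mul, ← ENNReal.tsum_mul_left, ← mul_assoc, pow_succ']
  rfl

/-- Finite horizons allow induction even though the full metric may be infinite; a supersolution is
compared with them first. -/
lemma metricUpTo_succ (lam mu : I) (b : ℝ≥0∞) (r : Slot → ℝ≥0∞) (n : ℕ) (π : Policy)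
    (y : State) :
    metricUpTo lam mu b r (n + 1) π y = expect (slotLaw π 0 y) fun s =>
      r s + b * expect (nextState lam mu s.1 s.2) (metricUpTo lam mu b r n π.shift) := by
  have hsum : ∀ (α : Type) (p : PMF α) (g : ℕ → α → ℝ≥0∞),
      expect p (fun a => ∑ t ∈ Finset.range n, g t a) = ∑ t ∈ Finset.range n, expect p (g t) := by
    intro α p g
    simp only [expect, Finset.mul_sum]
    exact Summable.tsum_finsetSum fun _ _ => ENNReal.summable
  rw [metricUpTo, Finset.sum_range_succ', add_comm, expect_add, pow_zero, one_mul,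
    expect_const_mul]
  simp only [slotLawAt_succ_eq_shift, expect_bind]
  change _ + _ = _ + b * expect _ fun s => expect _ fun y' => ∑ t ∈ Finset.range n, _
  simp only [hsum, expect_const_mul, Finset.mul_sum, ← mul_assoc, pow_succ']
  rfl

/-- A supersolution of the one-step recursion of a stationary policy dominates its metric. -/
lemma metric_le_of_supersolution (lam mu : I) (b : ℝ≥0∞) (r : Slot → ℝ≥0∞)
    (π : StationaryPolicy) (u : State → ℝ≥0∞)
    (hu : ∀ y, (expect (slotLaw π.toPolicy 0 y) fun s =>
      r s + b * expect (nextState lam mu s.1 s.2) u) ≤ u y) (y : State) :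
    metric lam mu b r π.toPolicy y ≤ u y := by
  have h : ∀ n y, metricUpTo lam mu b r n π.toPolicy y ≤ u y := by
    intro n
    induction n with
    | zero => intro y; simp [metricUpTo]
    | succ n ih =>
      intro y
      rw [metricUpTo_succ]
      refine (expect_mono _ fun s => ?_).trans (hu y)
      exact add_le_add le_rfl (mul_le_mul_right (expect_mono _ ih) _)
  rw [metric, ENNReal.tsum_eq_iSup_nat]
  exact iSup_le fun n => h n y

lemma expect_slotLaw_false (π : Policy) (t : ℕ) (i : ℕ+) (g : Slot → ℝ≥0∞) :
    expect (slotLaw π t (false, i)) g = g ((false, i), false) := by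
  simp [slotLaw, actionLaw, expect_map, expect_pure]

lemma expect_slotLaw_true (π : Policy) (t : ℕ) (i : ℕ+) (g : Slot → ℝ≥0∞) :
    expect (slotLaw π t (true, i)) g =
      ENNReal.ofReal (π t i) * g ((true, i), true) +
        ENNReal.ofReal (1 - π t i) * g ((true, i), false) := by
  simp [slotLaw, actionLaw, expect_map, expect_coin]

lemma expect_nextState_passive (lam mu : I) (y : State) (u : State → ℝ≥0∞) :
    expect (nextState lam mu y false) u = arrivalMean lam u (y.2 + 1) := by
  rw [expect_nextState, Bool.and_false, if_neg Bool.false_ne_true, ← add_mul,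
    ofReal_add_ofReal_one_sub, one_mul]

lemma expect_nextState_active (lam mu : I) (i : ℕ+) (u : State → ℝ≥0∞) :
    expect (nextState lam mu (true, i) true) u =
      ENNReal.ofReal mu * arrivalMean lam u 1 +
        ENNReal.ofReal (1 - mu) * arrivalMean lam u (i + 1) := by
  rw [expect_nextState]
  rfl

end AoI

end

noncomputable section

namespace AoI

/-! ### One-step recursions of the cost and work metrics -/

section Recursion

variable {lam mu : I} {β : ℝ}

lemma costMetric_false (hβ : 0 ≤ β) (c : ℕ+ → ℝ) (π : Policy) (i : ℕ+) :
    costMetric lam mu β c π (false, i) = ENNReal.ofReal (c i) +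
      ENNReal.ofReal β * arrivalMean lam (costMetric lam mu β c π.shift) (i + 1) := by
  have h : costMetric lam mu β c π.shift = _ :=
    funext fun y => costMetric_eq_metric lam mu hβ c π.shift y
  rw [h, costMetric_eq_metric lam mu hβ, metric_eq_expect, expect_slotLaw_false,
    expect_nextState_passive]

lemma workMetric_false (hβ : 0 ≤ β) (π : Policy) (i : ℕ+) :
    workMetric lam mu β π (false, i) =
      ENNReal.ofReal β * arrivalMean lam (workMetric lam mu β π.shift) (i + 1) := by
  have h : workMetric lam mu β π.shift = _ :=
    funext fun y => workMetric_eq_metric lam mu hβ π.shift y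
  rw [h, workMetric_eq_metric lam mu hβ, metric_eq_expect, expect_slotLaw_false,
    expect_nextState_passive]
  simp

/-- Mixing the outcomes of the two actions with weight `x` on transmission. -/
lemma mix_actions (x mu : I) (r₁ r₀ b A₁ A₂ : ℝ≥0∞) :
    ENNReal.ofReal x * (r₁ + b * (ENNReal.ofReal mu * A₁ + ENNReal.ofReal (1 - mu) * A₂)) +
        ENNReal.ofReal (1 - x) * (r₀ + b * A₂) =
      ENNReal.ofReal x * r₁ + ENNReal.ofReal (1 - x) * r₀ +
        b * (ENNReal.ofReal (x * mu) * A₁ + ENNReal.ofReal (1 - x * mu) * A₂) := by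
  have h : (1 : ℝ) - x * mu = x * (1 - mu) + (1 - x) := by ring
  rw [h, ENNReal.ofReal_add (mul_nonneg x.2.1 (sub_nonneg.2 mu.2.2)) (sub_nonneg.2 x.2.2),
    ENNReal.ofReal_mul x.2.1, ENNReal.ofReal_mul x.2.1]
  ring

lemma costMetric_true (hβ : 0 ≤ β) (c : ℕ+ → ℝ) (π : Policy) (i : ℕ+) :
    costMetric lam mu β c π (true, i) = ENNReal.ofReal (c i) + ENNReal.ofReal β *
      (ENNReal.ofReal (π 0 i * mu) * arrivalMean lam (costMetric lam mu β c π.shift) 1 +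
        ENNReal.ofReal (1 - π 0 i * mu) *
          arrivalMean lam (costMetric lam mu β c π.shift) (i + 1)) := by
  have h : costMetric lam mu β c π.shift = _ :=
    funext fun y => costMetric_eq_metric lam mu hβ c π.shift y
  rw [h, costMetric_eq_metric lam mu hβ, metric_eq_expect, expect_slotLaw_true,
    expect_nextState_passive, expect_nextState_active, mix_actions, ← add_mul,
    ofReal_add_ofReal_one_sub, one_mul]

lemma workMetric_true (hβ : 0 ≤ β) (π : Policy) (i : ℕ+) :
    workMetric lam mu β π (true, i) = ENNReal.ofReal (π 0 i) + ENNReal.ofReal β *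
      (ENNReal.ofReal (π 0 i * mu) * arrivalMean lam (workMetric lam mu β π.shift) 1 +
        ENNReal.ofReal (1 - π 0 i * mu) *
          arrivalMean lam (workMetric lam mu β π.shift) (i + 1)) := by
  have h : workMetric lam mu β π.shift = _ :=
    funext fun y => workMetric_eq_metric lam mu hβ π.shift y
  rw [h, workMetric_eq_metric lam mu hβ, metric_eq_expect, expect_slotLaw_true,
    expect_nextState_passive, expect_nextState_active, mix_actions]
  simp

/-- Averaging the one-step recursion over the arrival indicator. -/
lemma arrivalMean_step (lam mu x : I) (r₁ r₀ b A₁ A₂ : ℝ≥0∞) :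
    ENNReal.ofReal lam *
        (r₁ + b * (ENNReal.ofReal (x * mu) * A₁ + ENNReal.ofReal (1 - x * mu) * A₂)) +
        ENNReal.ofReal (1 - lam) * (r₀ + b * A₂) =
      ENNReal.ofReal lam * r₁ + ENNReal.ofReal (1 - lam) * r₀ +
        b * (ENNReal.ofReal (lam * mu * x) * A₁ + ENNReal.ofReal (1 - lam * mu * x) * A₂) := by
  have h := mix_actions lam (x * mu) r₁ r₀ b A₁ A₂
  rw [Set.Icc.coe_mul] at h
  rw [h, show (lam : ℝ) * mu * x = lam * (x * mu) by ring]

lemma arrivalMean_costMetric (hβ : 0 ≤ β) (c : ℕ+ → ℝ) (π : StationaryPolicy) (i : ℕ+) :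
    arrivalMean lam (costMetric lam mu β c π.toPolicy) i =
      ENNReal.ofReal (c i) + ENNReal.ofReal β *
        (ENNReal.ofReal (lam * mu * π i) * arrivalMean lam (costMetric lam mu β c π.toPolicy) 1 +
          ENNReal.ofReal (1 - lam * mu * π i) *
            arrivalMean lam (costMetric lam mu β c π.toPolicy) (i + 1)) := by
  conv_lhs => rw [arrivalMean, costMetric_true hβ, costMetric_false hβ]
  refine (arrivalMean_step lam mu (π i) _ _ _ _ _).trans ?_
  rw [← add_mul, ofReal_add_ofReal_one_sub, one_mul]
  rfl

lemma arrivalMean_workMetric (hβ : 0 ≤ β) (π : StationaryPolicy) (i : ℕ+) :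
    arrivalMean lam (workMetric lam mu β π.toPolicy) i =
      ENNReal.ofReal (lam * π i) + ENNReal.ofReal β *
        (ENNReal.ofReal (lam * mu * π i) * arrivalMean lam (workMetric lam mu β π.toPolicy) 1 +
          ENNReal.ofReal (1 - lam * mu * π i) *
            arrivalMean lam (workMetric lam mu β π.toPolicy) (i + 1)) := by
  conv_lhs => rw [arrivalMean, workMetric_true hβ, workMetric_false hβ]
  have h := arrivalMean_step lam mu (π i) (ENNReal.ofReal (π i)) 0 (ENNReal.ofReal β)
    (arrivalMean lam (workMetric lam mu β π.toPolicy) 1)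
    (arrivalMean lam (workMetric lam mu β π.toPolicy) (i + 1))
  rw [zero_add, mul_zero, add_zero] at h
  rw [ENNReal.ofReal_mul lam.2.1]
  exact h

lemma workMetric_le (hβ : 0 ≤ β) (hβ1 : β < 1) (π : Policy) (y : State) :
    workMetric lam mu β π y ≤ ENNReal.ofReal (1 - β)⁻¹ := by
  rw [workMetric_eq_metric lam mu hβ, metric]
  calc ∑' t, ENNReal.ofReal β ^ t *
        expect (slotLawAt lam mu π y t) (fun s => if s.2 then 1 else 0)
      ≤ ∑' t, ENNReal.ofReal β ^ t * 1 := by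
        refine ENNReal.tsum_le_tsum fun t => mul_le_mul_right ?_ _
        refine (expect_mono _ (h := fun _ => 1) fun s => ?_).trans (expect_const _ _).le
        split_ifs <;> simp
    _ = ENNReal.ofReal (1 - β)⁻¹ := by
        simp only [mul_one]
        rw [ENNReal.tsum_geometric, ENNReal.ofReal_inv_of_pos (sub_pos.2 hβ1),
          ENNReal.ofReal_sub _ hβ, ENNReal.ofReal_one]

lemma workMetric_ne_top (hβ : 0 ≤ β) (hβ1 : β < 1) (π : Policy) (y : State) :
    workMetric lam mu β π y ≠ ⊤ :=
  ((workMetric_le hβ hβ1 π y).trans_lt ENNReal.ofReal_lt_top).ne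

lemma arrivalMean_ne_top {u : State → ℝ≥0∞} {i : ℕ+} (h₁ : u (true, i) ≠ ⊤)
    (h₀ : u (false, i) ≠ ⊤) : arrivalMean lam u i ≠ ⊤ :=
  ENNReal.add_ne_top.2 ⟨ENNReal.mul_ne_top ENNReal.ofReal_ne_top h₁,
    ENNReal.mul_ne_top ENNReal.ofReal_ne_top h₀⟩

lemma ne_top_of_ofReal_mul {x : ℝ} (hx : 0 < x) {a : ℝ≥0∞}
    (h : ENNReal.ofReal x * a ≠ ⊤) : a ≠ ⊤ := by
  rintro rfl
  exact h (ENNReal.mul_top (ENNReal.ofReal_pos.2 hx).ne')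

lemma toReal_ofReal_mul {x : ℝ} (hx : 0 ≤ x) (a : ℝ≥0∞) :
    (ENNReal.ofReal x * a).toReal = x * a.toReal := by
  rw [ENNReal.toReal_mul, ENNReal.toReal_ofReal hx]

/-- A finite value `r + β (x A₁ + (1 - x) A₂)`: finiteness of the parts, and its real form. -/
lemma toReal_step {r x b : ℝ} (hr : 0 ≤ r) (hb : 0 < b) (hx0 : 0 ≤ x) (hx1 : x ≤ 1)
    {A₁ A₂ : ℝ≥0∞}
    (h : ENNReal.ofReal r + ENNReal.ofReal b *
      (ENNReal.ofReal x * A₁ + ENNReal.ofReal (1 - x) * A₂) ≠ ⊤) :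
    (0 < x → A₁ ≠ ⊤) ∧ (x < 1 → A₂ ≠ ⊤) ∧
      (ENNReal.ofReal r + ENNReal.ofReal b *
        (ENNReal.ofReal x * A₁ + ENNReal.ofReal (1 - x) * A₂)).toReal =
          r + b * (x * A₁.toReal + (1 - x) * A₂.toReal) := by
  obtain ⟨h1, h2⟩ := ENNReal.add_ne_top.1 (ne_top_of_ofReal_mul hb (ENNReal.add_ne_top.1 h).2)
  refine ⟨fun hx => ne_top_of_ofReal_mul hx h1,
    fun hx => ne_top_of_ofReal_mul (sub_pos.2 hx) h2, ?_⟩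
  rw [ENNReal.toReal_add ENNReal.ofReal_ne_top (ENNReal.add_ne_top.1 h).2,
    toReal_ofReal_mul hb.le, ENNReal.toReal_add h1 h2, toReal_ofReal_mul hx0,
    toReal_ofReal_mul (sub_nonneg.2 hx1), ENNReal.toReal_ofReal hr]

end Recursion

/-! ### The objective of a stationary policy in real terms -/

section RealForms

variable {lam mu : I} {β : ℝ} {c : ℕ+ → ℝ}

/-- The mean cost metric over the arrival indicator, as a real number. -/
def meanCost (lam mu : I) (β : ℝ) (c : ℕ+ → ℝ) (π : Policy) (i : ℕ+) : ℝ :=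
  (arrivalMean lam (costMetric lam mu β c π) i).toReal

/-- The mean work metric over the arrival indicator, as a real number. -/
def meanWork (lam mu : I) (β : ℝ) (π : Policy) (i : ℕ+) : ℝ :=
  (arrivalMean lam (workMetric lam mu β π) i).toReal

/-- The mean objective over the arrival indicator, as a real number. -/
def meanObjective (lam mu : I) (β : ℝ) (c : ℕ+ → ℝ) (ν : ℝ) (π : Policy) (i : ℕ+) : ℝ :=
  meanCost lam mu β c π i + ν * meanWork lam mu β π i

lemma mul_mem_unit (x y : I) : 0 ≤ (x : ℝ) * y ∧ (x : ℝ) * y ≤ 1 := by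
  rw [← Set.Icc.coe_mul]
  exact (x * y).2

lemma toReal_costMetric_false (hβ : 0 < β) (hc : ∀ i, 0 ≤ c i) (π : Policy) (i : ℕ+)
    (h : costMetric lam mu β c π (false, i) ≠ ⊤) :
    arrivalMean lam (costMetric lam mu β c π.shift) (i + 1) ≠ ⊤ ∧
      (costMetric lam mu β c π (false, i)).toReal =
        c i + β * meanCost lam mu β c π.shift (i + 1) := by
  rw [costMetric_false hβ.le] at h ⊢
  have h2 := (ENNReal.add_ne_top.1 h).2
  refine ⟨ne_top_of_ofReal_mul hβ h2, ?_⟩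
  rw [ENNReal.toReal_add ENNReal.ofReal_ne_top h2, toReal_ofReal_mul hβ.le,
    ENNReal.toReal_ofReal (hc i), meanCost]

/-- Since `0 * ⊤ = 0`, a finite cost says nothing about a successor of weight zero; finiteness is
claimed only for successors that are actually reached. -/
lemma toReal_costMetric_true (hβ : 0 < β) (hc : ∀ i, 0 ≤ c i) (π : Policy) (i : ℕ+)
    (h : costMetric lam mu β c π (true, i) ≠ ⊤) :
    (0 < (π 0 i : ℝ) * mu → arrivalMean lam (costMetric lam mu β c π.shift) 1 ≠ ⊤) ∧
      ((π 0 i : ℝ) * mu < 1 → arrivalMean lam (costMetric lam mu β c π.shift) (i + 1) ≠ ⊤) ∧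
      (costMetric lam mu β c π (true, i)).toReal =
        c i + β * (π 0 i * mu * meanCost lam mu β c π.shift 1 +
          (1 - π 0 i * mu) * meanCost lam mu β c π.shift (i + 1)) := by
  rw [costMetric_true hβ.le] at h ⊢
  exact toReal_step (hc i) hβ (mul_mem_unit _ _).1 (mul_mem_unit _ _).2 h

lemma toReal_workMetric_false (hβ : 0 < β) (π : Policy) (i : ℕ+) :
    (workMetric lam mu β π (false, i)).toReal = β * meanWork lam mu β π.shift (i + 1) := by
  rw [workMetric_false hβ.le, toReal_ofReal_mul hβ.le, meanWork]

lemma toReal_workMetric_true (hβ : 0 < β) (hβ1 : β < 1) (π : Policy) (i : ℕ+) :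
    (workMetric lam mu β π (true, i)).toReal =
      π 0 i + β * (π 0 i * mu * meanWork lam mu β π.shift 1 +
        (1 - π 0 i * mu) * meanWork lam mu β π.shift (i + 1)) := by
  have h := workMetric_ne_top (lam := lam) (mu := mu) hβ.le hβ1 π (true, i)
  rw [workMetric_true hβ.le] at h ⊢
  exact (toReal_step (π 0 i).2.1 hβ (mul_mem_unit _ _).1 (mul_mem_unit _ _).2 h).2.2

lemma meanCost_eq (hβ : 0 < β) (hc : ∀ i, 0 ≤ c i) (π : StationaryPolicy) (i : ℕ+)
    (h : arrivalMean lam (costMetric lam mu β c π.toPolicy) i ≠ ⊤) :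
    (0 < (lam : ℝ) * mu * π i → arrivalMean lam (costMetric lam mu β c π.toPolicy) 1 ≠ ⊤) ∧
      ((lam : ℝ) * mu * π i < 1 →
        arrivalMean lam (costMetric lam mu β c π.toPolicy) (i + 1) ≠ ⊤) ∧
      meanCost lam mu β c π.toPolicy i =
        c i + β * (lam * mu * π i * meanCost lam mu β c π.toPolicy 1 +
          (1 - lam * mu * π i) * meanCost lam mu β c π.toPolicy (i + 1)) := by
  have hp := mul_mem_unit (lam * mu) (π i)
  rw [Set.Icc.coe_mul] at hp
  have e := arrivalMean_costMetric (lam := lam) (mu := mu) hβ.le c π i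
  obtain ⟨h1, h2, h3⟩ := toReal_step (hc i) hβ hp.1 hp.2 (e ▸ h)
  exact ⟨h1, h2, (congrArg ENNReal.toReal e).trans h3⟩

lemma meanWork_eq (hβ : 0 < β) (hβ1 : β < 1) (π : StationaryPolicy) (i : ℕ+) :
    meanWork lam mu β π.toPolicy i =
      lam * π i + β * (lam * mu * π i * meanWork lam mu β π.toPolicy 1 +
        (1 - lam * mu * π i) * meanWork lam mu β π.toPolicy (i + 1)) := by
  have hp := mul_mem_unit (lam * mu) (π i)
  rw [Set.Icc.coe_mul] at hp
  have h : arrivalMean lam (workMetric lam mu β π.toPolicy) i ≠ ⊤ :=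
    arrivalMean_ne_top (workMetric_ne_top hβ.le hβ1 _ _) (workMetric_ne_top hβ.le hβ1 _ _)
  have e := arrivalMean_workMetric (lam := lam) (mu := mu) hβ.le π i
  exact (congrArg ENNReal.toReal e).trans
    (toReal_step (mul_mem_unit lam (π i)).1 hβ hp.1 hp.2 (e ▸ h)).2.2

lemma meanWork_nonneg (π : Policy) (i : ℕ+) : 0 ≤ meanWork lam mu β π i :=
  ENNReal.toReal_nonneg

lemma meanWork_le (hβ : 0 < β) (hβ1 : β < 1) (π : Policy) (i : ℕ+) :
    meanWork lam mu β π i ≤ (1 - β)⁻¹ := by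
  refine ENNReal.toReal_le_of_le_ofReal (inv_nonneg.2 (sub_nonneg.2 hβ1.le)) ?_
  calc arrivalMean lam (workMetric lam mu β π) i
      ≤ ENNReal.ofReal lam * ENNReal.ofReal (1 - β)⁻¹ +
          ENNReal.ofReal (1 - lam) * ENNReal.ofReal (1 - β)⁻¹ :=
        add_le_add (mul_le_mul_right (workMetric_le hβ.le hβ1 _ _) _)
          (mul_le_mul_right (workMetric_le hβ.le hβ1 _ _) _)
    _ = ENNReal.ofReal (1 - β)⁻¹ := by
        rw [← add_mul, ofReal_add_ofReal_one_sub, one_mul]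

/-- The mean objective of a stationary policy satisfies its evaluation equation. -/
lemma meanObjective_eq (hβ : 0 < β) (hβ1 : β < 1) (hc : ∀ i, 0 ≤ c i) (ν : ℝ)
    (π : StationaryPolicy) (i : ℕ+)
    (h : arrivalMean lam (costMetric lam mu β c π.toPolicy) i ≠ ⊤) :
    meanObjective lam mu β c ν π.toPolicy i =
      c i + lam * π i * ν + β * (lam * mu * π i * meanObjective lam mu β c ν π.toPolicy 1 +
        (1 - lam * mu * π i) * meanObjective lam mu β c ν π.toPolicy (i + 1)) := by
  rw [meanObjective, (meanCost_eq hβ hc π i h).2.2, meanWork_eq hβ hβ1 π i, meanObjective,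
    meanObjective]
  ring

lemma objective_eq_coe (hβ : 0 < β) (hβ1 : β < 1) (ν : ℝ) (π : Policy) (y : State)
    (h : costMetric lam mu β c π y ≠ ⊤) :
    objective lam mu β c ν π y =
      (((costMetric lam mu β c π y).toReal + ν * (workMetric lam mu β π y).toReal : ℝ) :
        EReal) := by
  have hw := workMetric_ne_top (lam := lam) (mu := mu) hβ.le hβ1 π y
  rw [objective, EReal.coe_add, EReal.coe_mul, EReal.coe_ennreal_toReal h,
    EReal.coe_ennreal_toReal hw]

/-- The work metric is finite, so even a negative charge cannot compensate an infinite cost. -/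
lemma objective_eq_top (hβ : 0 < β) (hβ1 : β < 1) (ν : ℝ) (π : Policy) (y : State)
    (h : costMetric lam mu β c π y = ⊤) : objective lam mu β c ν π y = ⊤ := by
  rw [objective, h, EReal.coe_ennreal_top,
    ← EReal.coe_ennreal_toReal (workMetric_ne_top (lam := lam) (mu := mu) hβ.le hβ1 π y),
    ← EReal.coe_mul, EReal.top_add_coe]

end RealForms

end AoI

end

noncomputable section

namespace AoI

/-! ### Real sequences -/

/-- A bounded below sequence with `r * e (i + 1) ≤ e i` beyond `k` is nonnegative beyond `k`. -/
lemma nonneg_of_mul_succ_le {r B : ℝ} (hr0 : 0 ≤ r) (hr1 : r < 1) {k : ℕ} {e : ℕ+ → ℝ}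
    (he : ∀ i : ℕ+, k < (i : ℕ) → r * e (i + 1) ≤ e i)
    (hB : ∀ i : ℕ+, k < (i : ℕ) → -B ≤ e i) (i : ℕ+) (hi : k < (i : ℕ)) : 0 ≤ e i := by
  have h : ∀ n : ℕ, ∀ i : ℕ+, k < (i : ℕ) → r ^ n * -B ≤ e i := by
    intro n
    induction n with
    | zero => simpa using hB
    | succ n ih =>
      intro i hi
      have hi' : k < ((i + 1 : ℕ+) : ℕ) := by
        rw [PNat.add_coe]
        omega
      calc r ^ (n + 1) * -B = r * (r ^ n * -B) := by ring
        _ ≤ r * e (i + 1) := mul_le_mul_of_nonneg_left (ih _ hi') hr0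
        _ ≤ e i := he i hi
  have ht : Filter.Tendsto (fun n : ℕ => r ^ n * -B) Filter.atTop (nhds (0 * -B)) :=
    (tendsto_pow_atTop_nhds_zero_of_lt_one hr0 hr1).mul_const _
  rw [zero_mul] at ht
  exact le_of_tendsto' ht fun n => h n i hi

/-- A bounded sequence with `e i = r * e (i + 1)` beyond `k` vanishes beyond `k`. -/
lemma eq_zero_of_eq_mul_succ {r B : ℝ} (hr0 : 0 ≤ r) (hr1 : r < 1) {k : ℕ} {e : ℕ+ → ℝ}
    (he : ∀ i : ℕ+, k < (i : ℕ) → e i = r * e (i + 1))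
    (hB : ∀ i : ℕ+, k < (i : ℕ) → |e i| ≤ B) (i : ℕ+) (hi : k < (i : ℕ)) : e i = 0 := by
  refine le_antisymm ?_ (nonneg_of_mul_succ_le hr0 hr1 (fun i hi => (he i hi).ge)
    (fun i hi => (abs_le.1 (hB i hi)).1) i hi)
  refine neg_nonneg.1 (nonneg_of_mul_succ_le (e := fun i => -e i) hr0 hr1 (fun i hi => ?_)
    (fun i hi => neg_le_neg (abs_le.1 (hB i hi)).2) i hi)
  rw [he i hi, mul_neg]

lemma sum_Icc_one_succ (g : ℕ+ → ℝ) (i : ℕ+) :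
    ∑ j ∈ Finset.Icc 1 (i + 1), g j = (∑ j ∈ Finset.Icc 1 i, g j) + g (i + 1) := by
  have h : Finset.Icc 1 (i + 1) = insert (i + 1) (Finset.Icc 1 i) := by
    ext j
    simp only [Finset.mem_Icc, Finset.mem_insert, one_le, true_and]
    rw [le_iff_eq_or_lt, PNat.lt_add_one_iff]
  rw [h, Finset.sum_insert, add_comm]
  simp only [Finset.mem_Icc, not_and, not_le]
  exact fun _ => PNat.lt_add_right i 1

/-- The discounted cost collected while the age grows from `1` to `i`. -/
lemma mul_one_eq_sum_add {β : ℝ} {c W : ℕ+ → ℝ} (i : ℕ+)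
    (hW : ∀ j < i, W j = c j + β * W (j + 1)) :
    β * W 1 = (∑ j ∈ Finset.Icc 1 i, β ^ (j : ℕ) * c j) + β ^ (i : ℕ) * (W i - c i) := by
  induction i using PNat.recOn with
  | one => simp; ring
  | succ i ih =>
    have hi := hW i (PNat.lt_add_right i 1)
    rw [sum_Icc_one_succ, ih fun j hj => hW j (hj.trans (PNat.lt_add_right i 1)), hi,
      PNat.add_coe, PNat.one_coe, pow_succ]
    ring

lemma sum_pow_Icc {β : ℝ} (hβ1 : β < 1) (i : ℕ+) :
    ∑ j ∈ Finset.Icc 1 i, β ^ (j : ℕ) = β * (1 - β ^ (i : ℕ)) / (1 - β) := by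
  have h1 : (1 : ℝ) - β ≠ 0 := (sub_pos.2 hβ1).ne'
  rw [eq_div_iff h1]
  induction i using PNat.recOn with
  | one => simp
  | succ i ih =>
    rw [sum_Icc_one_succ, add_mul, ih, PNat.add_coe, PNat.one_coe, pow_succ]
    ring

/-! ### The discounted tail cost -/

lemma pnat_mk_add_zero (i : ℕ+) : (⟨i + 0, Nat.add_pos_left i.pos 0⟩ : ℕ+) = i := rfl

lemma pnat_mk_add_succ (i : ℕ+) (j : ℕ) :
    (⟨i + (j + 1), Nat.add_pos_left i.pos (j + 1)⟩ : ℕ+) =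
      ⟨(i + 1 : ℕ+) + j, Nat.add_pos_left (i + 1 : ℕ+).pos j⟩ := by
  apply PNat.eq
  simp only [PNat.mk_coe, PNat.add_coe, PNat.one_coe]
  ring

section TailCost

variable {β q : ℝ} {c : ℕ+ → ℝ}

lemma summable_tail (hβ0 : 0 ≤ β) (hβ1 : β ≤ 1) (hq0 : 0 ≤ q) (hc0 : ∀ i, 0 ≤ c i)
    (hsum : Summable fun i : ℕ+ => c i * q ^ (i : ℕ)) (i : ℕ+) :
    Summable fun j : ℕ => (β * q) ^ j * c ⟨i + j, Nat.add_pos_left i.pos j⟩ := by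
  -- For `q = 0` the hypothesis `hsum` carries no information, but only the term `j = 0` survives.
  -- For `q > 0` the terms are dominated by those of `hsum`, rescaled by `q ^ (-i)`.
  rcases hq0.eq_or_lt with rfl | hq
  · refine summable_of_ne_finset_zero (s := {0}) fun j hj => ?_
    rw [mul_zero, zero_pow (by simpa using hj), zero_mul]
  · have hinj : Function.Injective fun j : ℕ => (⟨i + j, Nat.add_pos_left i.pos j⟩ : ℕ+) := by
      intro a b hab
      have := congrArg PNat.val hab
      simpa using this
    refine Summable.of_nonneg_of_le
      (fun j => mul_nonneg (pow_nonneg (mul_nonneg hβ0 hq0) _) (hc0 _)) (fun j => ?_)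
      ((hsum.comp_injective hinj).mul_left (q ^ (i : ℕ))⁻¹)
    have key : ∀ x : ℝ, 0 ≤ x → (β * q) ^ j * x ≤ (q ^ (i : ℕ))⁻¹ * (x * q ^ ((i : ℕ) + j)) := by
      intro x hx
      rw [pow_add, mul_pow, mul_left_comm x, inv_mul_cancel_left₀ (pow_pos hq _).ne',
        mul_comm x, mul_assoc]
      exact mul_le_of_le_one_left (mul_nonneg (pow_nonneg hq0 _) hx) (pow_le_one₀ hβ0 hβ1)
    exact key _ (hc0 _)

lemma tailCost_eq (hs : ∀ i : ℕ+, Summable fun j : ℕ =>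
      (β * q) ^ j * c ⟨i + j, Nat.add_pos_left i.pos j⟩) (i : ℕ+) :
    tailCost β c q i = c i + β * q * tailCost β c q (i + 1) := by
  rw [tailCost, (hs i).tsum_eq_zero_add, tailCost, ← tsum_mul_left]
  simp only [pnat_mk_add_succ, pnat_mk_add_zero, pow_zero, one_mul, pow_succ', mul_assoc]

lemma tailCost_nonneg (hβ0 : 0 ≤ β) (hq0 : 0 ≤ q) (hc0 : ∀ i, 0 ≤ c i) (i : ℕ+) :
    0 ≤ tailCost β c q i :=
  tsum_nonneg fun _ => mul_nonneg (pow_nonneg (mul_nonneg hβ0 hq0) _) (hc0 _)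

lemma tailCost_mono (hβ0 : 0 ≤ β) (hq0 : 0 ≤ q) (hc : Monotone c)
    (hs : ∀ i : ℕ+, Summable fun j : ℕ =>
      (β * q) ^ j * c ⟨i + j, Nat.add_pos_left i.pos j⟩) : Monotone (tailCost β c q) := by
  intro i i' h
  refine (hs i).tsum_le_tsum (fun j => ?_) (hs i')
  refine mul_le_mul_of_nonneg_left (hc ?_) (pow_nonneg (mul_nonneg hβ0 hq0) _)
  exact Subtype.mk_le_mk.2 (Nat.add_le_add_right h j)

/-- The right side is a weighted average of `c i, c (i + 1), …`, and costs are nondecreasing. -/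
lemma le_tailCost (hβ0 : 0 ≤ β) (hq0 : 0 ≤ q) (hc : Monotone c)
    (hs : ∀ i : ℕ+, Summable fun j : ℕ =>
      (β * q) ^ j * c ⟨i + j, Nat.add_pos_left i.pos j⟩) (i : ℕ+) :
    c i ≤ (1 - β * q) * tailCost β c q i := by
  have h1 := tailCost_eq hs i
  have h2 := mul_le_mul_of_nonneg_left
    (tailCost_mono hβ0 hq0 hc hs (PNat.lt_add_right i 1).le) (mul_nonneg hβ0 hq0)
  linarith

lemma sum_range_le_of_step (hβ0 : 0 ≤ β) (hq0 : 0 ≤ q) (hc0 : ∀ i, 0 ≤ c i)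
    {A : ℕ+ → ℝ≥0∞}
    (hA : ∀ i, ENNReal.ofReal (c i) + ENNReal.ofReal (β * q) * A (i + 1) ≤ A i) (n : ℕ) (i : ℕ+) :
    ENNReal.ofReal (∑ j ∈ Finset.range n, (β * q) ^ j * c ⟨i + j, Nat.add_pos_left i.pos j⟩) ≤
      A i := by
  induction n generalizing i with
  | zero => simp
  | succ n ih =>
    refine le_trans ?_ (hA i)
    refine le_trans ?_ (add_le_add le_rfl (mul_le_mul_right (ih (i + 1)) _))
    have hbq := mul_nonneg hβ0 hq0
    have hnn : 0 ≤ ∑ j ∈ Finset.range n, (β * q) ^ j *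
        c ⟨(i + 1 : ℕ+) + j, Nat.add_pos_left (i + 1 : ℕ+).pos j⟩ :=
      Finset.sum_nonneg fun j _ => mul_nonneg (pow_nonneg hbq _) (hc0 _)
    refine le_of_eq ?_
    rw [← ENNReal.ofReal_mul hbq, ← ENNReal.ofReal_add (hc0 i) (mul_nonneg hbq hnn),
      Finset.sum_range_succ', add_comm, Finset.mul_sum]
    simp only [pnat_mk_add_succ, pnat_mk_add_zero, pow_zero, one_mul, pow_succ', mul_assoc]

/-- The tail cost is a lower bound for values that survive a slot with probability `q`. -/
lemma tailCost_le_of_step (hβ0 : 0 ≤ β) (hq0 : 0 ≤ q) (hc0 : ∀ i, 0 ≤ c i)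
    (hs : ∀ i : ℕ+, Summable fun j : ℕ =>
      (β * q) ^ j * c ⟨i + j, Nat.add_pos_left i.pos j⟩) {A : ℕ+ → ℝ≥0∞}
    (hA : ∀ i, ENNReal.ofReal (c i) + ENNReal.ofReal (β * q) * A (i + 1) ≤ A i) (i : ℕ+)
    (hi : A i ≠ ⊤) : tailCost β c q i ≤ (A i).toReal :=
  le_of_tendsto' (hs i).hasSum.tendsto_sum_nat fun n =>
    (ENNReal.ofReal_le_iff_le_toReal hi).1 (sum_range_le_of_step hβ0 hq0 hc0 hA n i)

end TailCost

/-! ### The closed form of the index and its sign relations -/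

/-- The standing assumptions on the parameters: arrival probability `l`, channel probability
`m`, discount factor `β`, survival probability `q` and cost function `c`. -/
structure Params (l m β q : ℝ) (c : ℕ+ → ℝ) : Prop where
  l_pos : 0 < l
  l_le : l ≤ 1
  m_pos : 0 < m
  m_le : m ≤ 1
  beta_pos : 0 < β
  beta_lt : β < 1
  q_eq : q = 1 - l * m
  c_nonneg : ∀ i, 0 ≤ c i
  c_mono : Monotone c
  summable : ∀ i : ℕ+, Summable fun j : ℕ =>
    (β * q) ^ j * c ⟨i + j, Nat.add_pos_left i.pos j⟩

namespace Params

variable {l m β q : ℝ} {c : ℕ+ → ℝ}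

lemma p_pos (h : Params l m β q c) : 0 < l * m := mul_pos h.l_pos h.m_pos

lemma p_le (h : Params l m β q c) : l * m ≤ 1 :=
  mul_le_one₀ h.l_le h.m_pos.le h.m_le

lemma q_nonneg (h : Params l m β q c) : 0 ≤ q := by linarith [h.q_eq, h.p_le]

lemma q_le (h : Params l m β q c) : q ≤ 1 := by linarith [h.q_eq, h.p_pos]

lemma bq_nonneg (h : Params l m β q c) : 0 ≤ β * q := mul_nonneg h.beta_pos.le h.q_nonneg

lemma bq_lt (h : Params l m β q c) : β * q < 1 :=
  (mul_le_of_le_one_right h.beta_pos.le h.q_le).trans_lt h.beta_lt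

lemma one_sub_pos (h : Params l m β q c) : 0 < 1 - β := sub_pos.2 h.beta_lt

lemma tail_eq (h : Params l m β q c) (i : ℕ+) :
    tailCost β c q i = c i + β * q * tailCost β c q (i + 1) := tailCost_eq h.summable i

lemma tail_nonneg (h : Params l m β q c) (i : ℕ+) : 0 ≤ tailCost β c q i :=
  tailCost_nonneg h.beta_pos.le h.q_nonneg h.c_nonneg i

lemma tail_mono (h : Params l m β q c) : Monotone (tailCost β c q) :=
  tailCost_mono h.beta_pos.le h.q_nonneg h.c_mono h.summable

lemma le_tail (h : Params l m β q c) (i : ℕ+) : c i ≤ (1 - β * q) * tailCost β c q i :=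
  le_tailCost h.beta_pos.le h.q_nonneg h.c_mono h.summable i

end Params

/-- The closed form of the marginal productivity index. -/
def indexFormula (m β q : ℝ) (c : ℕ+ → ℝ) (i : ℕ+) : ℝ :=
  m * (β * (1 - β ^ (i : ℕ)) * (1 - β * q) / (1 - β) * tailCost β c q (i + 1) -
    ∑ j ∈ Finset.Icc 1 i, β ^ (j : ℕ) * c j)

/-- The advantage of transmitting in state `(1, i)`, given mean values `W` in the next slot. -/
def advantage (m β ν : ℝ) (W : ℕ+ → ℝ) (i : ℕ+) : ℝ := β * m * (W (i + 1) - W 1) - ν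

/-- `W` solves the evaluation equation of the `k`-threshold policy, and differs from the tail
cost by the constant `κ` beyond the threshold. -/
structure ThresholdValue (l m β q ν : ℝ) (c W : ℕ+ → ℝ) (k : ℕ) (κ : ℝ) : Prop where
  below : ∀ i : ℕ+, (i : ℕ) ≤ k → W i = c i + β * W (i + 1)
  above : ∀ i : ℕ+, k < (i : ℕ) → W i = c i + β * W (i + 1) - l * advantage m β ν W i
  tail : ∀ i : ℕ+, k < (i : ℕ) → W i = tailCost β c q i + κ

section Index

variable {l m β q ν κ : ℝ} {c W : ℕ+ → ℝ} {k : ℕ}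

/-- In this form monotonicity is visible: raising `i` raises every summand and appends a nonnegative
one. -/
lemma Params.index_eq_sum (h : Params l m β q c) (i : ℕ+) :
    indexFormula m β q c i =
      m * ∑ j ∈ Finset.Icc 1 i, β ^ (j : ℕ) * ((1 - β * q) * tailCost β c q (i + 1) - c j) := by
  simp only [indexFormula, mul_sub, Finset.sum_sub_distrib, ← Finset.sum_mul,
    sum_pow_Icc h.beta_lt]
  ring

lemma Params.index_mono (h : Params l m β q c) : Monotone (indexFormula m β q c) := by
  refine monotone_of_le_succ fun i _ => ?_
  rw [Order.succ_eq_add_one, h.index_eq_sum, h.index_eq_sum, sum_Icc_one_succ]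
  refine mul_le_mul_of_nonneg_left ?_ h.m_pos.le
  have hb := sub_nonneg.2 h.bq_lt.le
  have hT := mul_le_mul_of_nonneg_left (h.tail_mono (PNat.lt_add_right (i + 1) 1).le) hb
  have hlast : 0 ≤ β ^ ((i + 1 : ℕ+) : ℕ) *
      ((1 - β * q) * tailCost β c q (i + 1 + 1) - c (i + 1)) := by
    refine mul_nonneg (pow_nonneg h.beta_pos.le _) ?_
    linarith [h.le_tail (i + 1)]
  have hsum : ∑ j ∈ Finset.Icc 1 i, β ^ (j : ℕ) *
        ((1 - β * q) * tailCost β c q (i + 1) - c j) ≤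
      ∑ j ∈ Finset.Icc 1 i, β ^ (j : ℕ) * ((1 - β * q) * tailCost β c q (i + 1 + 1) - c j) :=
    Finset.sum_le_sum fun j _ => mul_le_mul_of_nonneg_left (by linarith)
      (pow_nonneg h.beta_pos.le _)
  linarith

/-! ### Sign of the advantage under a threshold policy -/

namespace ThresholdValue

/-- Subtracting the tail recursion from the evaluation equation at age `k + 1` leaves an equation
for the constant alone. -/
lemma const_eq (hp : Params l m β q c) (h : ThresholdValue l m β q ν c W k κ) :
    (1 - β * q) * κ = l * ν + β * (l * m) * W 1 := by
  obtain ⟨i, hi⟩ : ∃ i : ℕ+, (i : ℕ) = k + 1 := ⟨⟨k + 1, k.succ_pos⟩, rfl⟩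
  have hi1 : k < (i : ℕ) := by omega
  have hi2 : k < ((i + 1 : ℕ+) : ℕ) := by rw [PNat.add_coe, PNat.one_coe]; omega
  have e := h.above i hi1
  have e1 := h.tail i hi1
  have e2 := h.tail (i + 1) hi2
  have e3 := hp.tail_eq i
  have e4 := hp.q_eq
  rw [advantage] at e
  subst e4
  linear_combination e - e1 - e3 + (β - β * (l * m)) * e2

/-- Four linear relations (telescoped costs, the equation at `i`, the tail form at `i + 1`, the
value of `κ`) eliminate `W 1`, `W i`, `W (i + 1)` and `κ`. -/
lemma advantage_at (hp : Params l m β q c) (h : ThresholdValue l m β q ν c W k κ) (i : ℕ+)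
    (hi : (i : ℕ) = k) :
    advantage m β ν W i * (1 - β * q - β * β ^ (i : ℕ) * (l * m)) =
      (1 - β) * (indexFormula m β q c i - ν) := by
  have hi2 : k < ((i + 1 : ℕ+) : ℕ) := by rw [PNat.add_coe, PNat.one_coe]; omega
  have e1 := mul_one_eq_sum_add (W := W) i fun j hj => h.below j
    (((PNat.coe_lt_coe _ _).2 hj).le.trans hi.le)
  have e2 := h.below i hi.le
  have e3 := h.tail (i + 1) hi2
  have e4 := h.const_eq hp
  have h1 := hp.one_sub_pos.ne'
  have e5 := hp.q_eq
  have e6 : (1 - β) * indexFormula m β q c i =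
      m * (β * (1 - β ^ (i : ℕ)) * (1 - β * q) * tailCost β c q (i + 1) -
        (1 - β) * ∑ j ∈ Finset.Icc 1 i, β ^ (j : ℕ) * c j) := by
    rw [indexFormula]
    field_simp
  rw [mul_sub (1 - β) _ ν, e6, advantage]
  generalize (∑ j ∈ Finset.Icc 1 i, β ^ (j : ℕ) * c j) = T at *
  generalize β ^ (i : ℕ) = b at *
  subst e5
  linear_combination (-(m * (1 - β))) * e1 + (-(m * (1 - β) * b)) * e2 +
    (m * β * (1 - b) * (1 - β * (1 - l * m))) * e3 + (m * β * (1 - b)) * e4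

/-- The same elimination one age later, where the policy transmits; only the equation at `i`, and
hence the weight, changes. -/
lemma advantage_succ (hp : Params l m β q c) (h : ThresholdValue l m β q ν c W k κ) (i : ℕ+)
    (hi : (i : ℕ) = k + 1) :
    advantage m β ν W i *
        ((1 - β) * (1 - β ^ (i : ℕ) * (l * m)) + (1 - β ^ (i : ℕ)) * (β * (l * m))) =
      (1 - β) * (indexFormula m β q c i - ν) := by
  have hi1 : k < (i : ℕ) := by omega
  have hi2 : k < ((i + 1 : ℕ+) : ℕ) := by rw [PNat.add_coe, PNat.one_coe]; omega
  have e1 := mul_one_eq_sum_add (W := W) i fun j hj => h.below j (by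
    have := (PNat.coe_lt_coe _ _).2 hj
    omega)
  have e2 := h.above i hi1
  have e3 := h.tail (i + 1) hi2
  have e4 := h.const_eq hp
  have h1 := hp.one_sub_pos.ne'
  have e5 := hp.q_eq
  have e6 : (1 - β) * indexFormula m β q c i =
      m * (β * (1 - β ^ (i : ℕ)) * (1 - β * q) * tailCost β c q (i + 1) -
        (1 - β) * ∑ j ∈ Finset.Icc 1 i, β ^ (j : ℕ) * c j) := by
    rw [indexFormula]
    field_simp
  rw [mul_sub (1 - β) _ ν, e6]
  rw [advantage] at e2 ⊢
  generalize (∑ j ∈ Finset.Icc 1 i, β ^ (j : ℕ) * c j) = T at *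
  generalize β ^ (i : ℕ) = b at *
  subst e5
  linear_combination (-(m * (1 - β))) * e1 + (-(m * (1 - β) * b)) * e2 +
    (m * β * (1 - b) * (1 - β * (1 - l * m))) * e3 + (m * β * (1 - b)) * e4

/-- The weight equals `(1 - β) + β l m (1 - β ^ i)`. -/
lemma weight_pos (hp : Params l m β q c) (i : ℕ+) :
    0 < 1 - β * q - β * β ^ (i : ℕ) * (l * m) := by
  have h1 := mul_nonneg (mul_nonneg hp.beta_pos.le hp.p_pos.le)
    (sub_nonneg.2 (pow_le_one₀ hp.beta_pos.le hp.beta_lt.le : β ^ (i : ℕ) ≤ 1))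
  have h2 := hp.one_sub_pos
  rw [hp.q_eq]
  nlinarith

lemma weight_succ_pos (hp : Params l m β q c) (i : ℕ+) :
    0 < (1 - β) * (1 - β ^ (i : ℕ) * (l * m)) + (1 - β ^ (i : ℕ)) * (β * (l * m)) := by
  have hb : β ^ (i : ℕ) < 1 := pow_lt_one₀ hp.beta_pos.le hp.beta_lt i.ne_zero
  have h3 : β ^ (i : ℕ) * (l * m) < 1 :=
    (mul_le_of_le_one_right (pow_nonneg hp.beta_pos.le _) hp.p_le).trans_lt hb
  exact add_pos_of_pos_of_nonneg (mul_pos hp.one_sub_pos (sub_pos.2 h3))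
    (mul_nonneg (sub_nonneg.2 hb.le) (mul_nonneg hp.beta_pos.le hp.p_pos.le))

lemma advantage_at_nonpos (hp : Params l m β q c) (h : ThresholdValue l m β q ν c W k κ) (i : ℕ+)
    (hi : (i : ℕ) = k) (hν : indexFormula m β q c i ≤ ν) : advantage m β ν W i ≤ 0 := by
  have e := h.advantage_at hp i hi
  have := mul_nonpos_of_nonneg_of_nonpos hp.one_sub_pos.le (sub_nonpos.2 hν)
  exact nonpos_of_mul_nonpos_left (e ▸ this) (weight_pos hp i)

/-- Monotonicity spreads downwards from the region beyond `k`, where the tail cost gives it. The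
hypothesis at age `k` is vacuous for `k = 0`, as ages are positive. -/
lemma le_succ (hp : Params l m β q c) (h : ThresholdValue l m β q ν c W k κ)
    (hk : ∀ i : ℕ+, (i : ℕ) = k → advantage m β ν W i ≤ 0) (i : ℕ+) : W i ≤ W (i + 1) := by
  have habove : ∀ i : ℕ+, k < (i : ℕ) → W i ≤ W (i + 1) := by
    intro i hi
    have hi2 : k < ((i + 1 : ℕ+) : ℕ) := by rw [PNat.add_coe, PNat.one_coe]; omega
    rw [h.tail i hi, h.tail (i + 1) hi2]
    exact add_le_add (hp.tail_mono (PNat.lt_add_right i 1).le) le_rfl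
  have hle : ∀ n : ℕ, ∀ i : ℕ+, k < (i : ℕ) + n → W i ≤ W (i + 1) := by
    intro n
    induction n with
    | zero => exact habove
    | succ n ih =>
      intro i hi
      by_cases hin : k < (i : ℕ) + n
      · exact ih i hin
      have hd := ih (i + 1) (by rw [PNat.add_coe, PNat.one_coe]; omega)
      have hc := hp.c_mono (PNat.lt_add_right i 1).le
      have e1 := h.below i (by omega)
      -- For `n = 0`, `i` is the threshold itself and the two ages obey different equations: `W
      -- (i+1) - W i` equals `c (i+1) - c i + β q (W (i+2) - W (i+1)) - l A i`, with every part
      -- nonnegative.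
      rcases Nat.eq_zero_or_pos n with rfl | hn
      · have e2 := h.above (i + 1) (by rw [PNat.add_coe, PNat.one_coe]; omega)
        have e3 := mul_nonpos_of_nonneg_of_nonpos hp.l_pos.le (hk i (by omega))
        have e4 := mul_nonneg hp.bq_nonneg (sub_nonneg.2 hd)
        rw [hp.q_eq] at e4
        simp only [advantage] at e2 e3
        linarith
      · have e2 := h.below (i + 1) (by rw [PNat.add_coe, PNat.one_coe]; omega)
        have e3 := mul_le_mul_of_nonneg_left hd hp.beta_pos.le
        linarith
  exact hle (k + 1) i (by omega)

lemma advantage_mono (hp : Params l m β q c) (h : ThresholdValue l m β q ν c W k κ)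
    (hk : ∀ i : ℕ+, (i : ℕ) = k → indexFormula m β q c i ≤ ν) :
    Monotone (advantage m β ν W) := by
  refine monotone_of_le_succ fun i _ => ?_
  have h1 := h.le_succ hp (fun i hi => h.advantage_at_nonpos hp i hi (hk i hi)) (i + 1)
  exact sub_le_sub_right (mul_le_mul_of_nonneg_left (sub_le_sub_right h1 _)
    (mul_nonneg hp.beta_pos.le hp.m_pos.le)) _

lemma advantage_nonpos (hp : Params l m β q c) (h : ThresholdValue l m β q ν c W k κ)
    (hk : ∀ i : ℕ+, (i : ℕ) = k → indexFormula m β q c i ≤ ν) (i : ℕ+) (hi : (i : ℕ) ≤ k) :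
    advantage m β ν W i ≤ 0 := by
  have hk0 : 0 < k := i.pos.trans_le hi
  exact (h.advantage_mono hp hk (show i ≤ ⟨k, hk0⟩ from hi)).trans
    (h.advantage_at_nonpos hp ⟨k, hk0⟩ rfl (hk _ rfl))

lemma advantage_neg (hp : Params l m β q c) (h : ThresholdValue l m β q ν c W k κ)
    (hk : ∀ i : ℕ+, (i : ℕ) = k → indexFormula m β q c i < ν) (i : ℕ+) (hi : (i : ℕ) ≤ k) :
    advantage m β ν W i < 0 := by
  have hk0 : 0 < k := i.pos.trans_le hi
  refine (h.advantage_mono hp (fun i hi => (hk i hi).le)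
    (show i ≤ ⟨k, hk0⟩ from hi)).trans_lt ?_
  have e := h.advantage_at hp ⟨k, hk0⟩ rfl
  have := mul_neg_of_pos_of_neg hp.one_sub_pos (sub_neg.2 (hk ⟨k, hk0⟩ rfl))
  exact neg_of_mul_neg_left (e ▸ this) (weight_pos hp _).le

lemma advantage_nonneg (hp : Params l m β q c) (h : ThresholdValue l m β q ν c W k κ)
    (hk : ∀ i : ℕ+, (i : ℕ) = k → indexFormula m β q c i ≤ ν)
    (hk' : ν ≤ indexFormula m β q c k.succPNat) (i : ℕ+) (hi : k < (i : ℕ)) :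
    0 ≤ advantage m β ν W i := by
  refine le_trans ?_ (h.advantage_mono hp hk (show k.succPNat ≤ i from hi))
  have e := h.advantage_succ hp k.succPNat rfl
  have := mul_nonneg hp.one_sub_pos.le (sub_nonneg.2 hk')
  exact nonneg_of_mul_nonneg_left (e ▸ this) (weight_succ_pos hp _)

lemma advantage_pos (hp : Params l m β q c) (h : ThresholdValue l m β q ν c W k κ)
    (hk : ∀ i : ℕ+, (i : ℕ) = k → indexFormula m β q c i ≤ ν)
    (hk' : ν < indexFormula m β q c k.succPNat) (i : ℕ+) (hi : k < (i : ℕ)) :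
    0 < advantage m β ν W i := by
  refine lt_of_lt_of_le ?_ (h.advantage_mono hp hk (show k.succPNat ≤ i from hi))
  have e := h.advantage_succ hp k.succPNat rfl
  have := mul_pos hp.one_sub_pos (sub_pos.2 hk')
  exact pos_of_mul_pos_left (e ▸ this) (weight_succ_pos hp _).le

end ThresholdValue

/-! ### The policy that never transmits -/

/-- All summands in `index_eq_sum` are nonnegative; the one at `j = 1` already suffices. -/
lemma Params.mul_sub_le_index (hp : Params l m β q c) (i : ℕ+) :
    β * m * (c (i + 1) - c 1) ≤ indexFormula m β q c i := by
  rw [hp.index_eq_sum, mul_comm β, mul_assoc]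
  refine mul_le_mul_of_nonneg_left ?_ hp.m_pos.le
  have h1 : ∀ j ∈ Finset.Icc 1 i,
      0 ≤ β ^ (j : ℕ) * ((1 - β * q) * tailCost β c q (i + 1) - c j) := by
    intro j hj
    refine mul_nonneg (pow_nonneg hp.beta_pos.le _) ?_
    have h1 := hp.c_mono (((Finset.mem_Icc.1 hj).2).trans (PNat.lt_add_right i 1).le)
    linarith [hp.le_tail (i + 1)]
  refine le_trans ?_ (Finset.single_le_sum h1 (Finset.mem_Icc.2 ⟨le_rfl, one_le⟩ :
    (1 : ℕ+) ∈ Finset.Icc 1 i))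
  rw [PNat.one_coe, pow_one]
  exact mul_le_mul_of_nonneg_left (by linarith [hp.le_tail (i + 1)]) hp.beta_pos.le

/-- If no index exceeds `ν`, the costs are bounded. -/
lemma Params.cost_le_of_index_le (hp : Params l m β q c)
    (hν : ∀ i, indexFormula m β q c i ≤ ν) (i : ℕ+) : c i ≤ c 1 + ν / (β * m) := by
  have h1 := (hp.mul_sub_le_index i).trans (hν i)
  rw [mul_comm, ← le_div_iff₀ (mul_pos hp.beta_pos hp.m_pos)] at h1
  linarith [hp.c_mono (PNat.lt_add_right i 1).le]

section NeverTransmit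

variable {B : ℝ}

/-- Exhibits the index through a convex combination, with weights `1 - β ^ i` and `β ^ i`, of a
normalised tail cost and `W (i + 1)`; both are at least `c (i + 1) / (1 - β)`. -/
lemma never_index_eq (hp : Params l m β q c) (hW : ∀ i, W i = c i + β * W (i + 1)) (i : ℕ+) :
    indexFormula m β q c i =
      β * m * ((1 - β ^ (i : ℕ)) * ((1 - β * q) * tailCost β c q (i + 1)) / (1 - β) +
        β ^ (i : ℕ) * W (i + 1) - W 1) := by
  have e := mul_one_eq_sum_add i fun j _ => hW j
  have e2 := hW i
  have h1 := hp.one_sub_pos.ne'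
  rw [indexFormula]
  field_simp
  linear_combination (m * (1 - β)) * e + (m * (1 - β) * β ^ (i : ℕ)) * e2

/-- The increments of `W` satisfy a discounted inequality and are bounded, hence nonnegative;
substitute in the recursion. -/
lemma never_cost_le (hp : Params l m β q c) (hW : ∀ i, W i = c i + β * W (i + 1))
    (hB : ∀ i, |W i| ≤ B) (i : ℕ+) : c i ≤ (1 - β) * W i := by
  have h := nonneg_of_mul_succ_le (k := 0) (e := fun i => W (i + 1) - W i) (B := 2 * B)
    hp.beta_pos.le hp.beta_lt (fun i _ => by
      have h1 := hp.c_mono (PNat.lt_add_right i 1).le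
      have h2 := hW i
      have h3 := hW (i + 1)
      change β * (W (i + 1 + 1) - W (i + 1)) ≤ W (i + 1) - W i
      linarith) (fun i _ => by
      have h1 := abs_le.1 (hB i)
      have h2 := abs_le.1 (hB (i + 1))
      change _ ≤ W (i + 1) - W i
      linarith) i i.pos
  have h2 := mul_nonneg hp.beta_pos.le h
  have h3 := hW i
  linarith

/-- The convex combination in `never_index_eq` bounds every cost by `(1 - β)` times the right side,
so discounting bounds the value by the right side itself. -/
lemma never_value_le (hp : Params l m β q c) (hW : ∀ i, W i = c i + β * W (i + 1))
    (hB : ∀ i, |W i| ≤ B) (hν : ∀ i, indexFormula m β q c i ≤ ν) (i : ℕ+) :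
    W i ≤ W 1 + ν / (β * m) := by
  have hbm := mul_pos hp.beta_pos hp.m_pos
  have h1 := hp.one_sub_pos
  have hc : ∀ i, c i ≤ (1 - β) * (W 1 + ν / (β * m)) := by
    intro i
    refine (hp.c_mono (PNat.lt_add_right i 1).le).trans ?_
    have e := never_index_eq hp hW i
    have hb0 := pow_nonneg hp.beta_pos.le (i : ℕ)
    have hb1 : β ^ (i : ℕ) ≤ 1 := pow_le_one₀ hp.beta_pos.le hp.beta_lt.le
    have e2 : c (i + 1) / (1 - β) - W 1 ≤ ν / (β * m) := by
      rw [le_div_iff₀ hbm, mul_comm]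
      refine le_trans ?_ (hν i)
      rw [e]
      refine mul_le_mul_of_nonneg_left ?_ hbm.le
      have e3 : (1 - β ^ (i : ℕ)) * c (i + 1) / (1 - β) ≤
          (1 - β ^ (i : ℕ)) * ((1 - β * q) * tailCost β c q (i + 1)) / (1 - β) :=
        div_le_div_of_nonneg_right
          (mul_le_mul_of_nonneg_left (hp.le_tail _) (sub_nonneg.2 hb1)) h1.le
      have e4 : β ^ (i : ℕ) * (c (i + 1) / (1 - β)) ≤ β ^ (i : ℕ) * W (i + 1) := by
        refine mul_le_mul_of_nonneg_left ?_ hb0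
        rw [div_le_iff₀ h1, mul_comm]
        exact never_cost_le hp hW hB _
      have e5 : c (i + 1) / (1 - β) = (1 - β ^ (i : ℕ)) * c (i + 1) / (1 - β) +
          β ^ (i : ℕ) * (c (i + 1) / (1 - β)) := by ring
      linarith
    have e6 : c (i + 1) / (1 - β) ≤ W 1 + ν / (β * m) := by linarith
    rw [div_le_iff₀ h1] at e6
    linarith
  have h := nonneg_of_mul_succ_le (k := 0) (e := fun i => W 1 + ν / (β * m) - W i)
    (B := B - (W 1 + ν / (β * m))) hp.beta_pos.le hp.beta_lt (fun i _ => by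
      have h2 := hW i
      have h3 := hc i
      change β * (W 1 + ν / (β * m) - W (i + 1)) ≤ W 1 + ν / (β * m) - W i
      linarith) (fun i _ => by
      have h1 := abs_le.1 (hB i)
      change _ ≤ W 1 + ν / (β * m) - W i
      linarith) i i.pos
  linarith

lemma never_advantage_nonpos (hp : Params l m β q c) (hW : ∀ i, W i = c i + β * W (i + 1))
    (hB : ∀ i, |W i| ≤ B) (hν : ∀ i, indexFormula m β q c i ≤ ν) (i : ℕ+) :
    advantage m β ν W i ≤ 0 := by
  have h1 := never_value_le hp hW hB hν (i + 1)
  have hbm := mul_pos hp.beta_pos hp.m_pos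
  have h2 : W (i + 1) - W 1 ≤ ν / (β * m) := by linarith
  rw [le_div_iff₀ hbm] at h2
  rw [advantage]
  linarith

/-- A zero advantage means that `W (i + 1)` attains the bound of `never_value_le`. Then `c (i + 1) ≥
(1 - β) W (i + 1)`, which forces the index at `i` up to `ν`. -/
lemma never_advantage_neg (hp : Params l m β q c) (hW : ∀ i, W i = c i + β * W (i + 1))
    (hB : ∀ i, |W i| ≤ B) (hν : ∀ i, indexFormula m β q c i ≤ ν) (i : ℕ+)
    (hi : indexFormula m β q c i < ν) : advantage m β ν W i < 0 := by
  refine (never_advantage_nonpos hp hW hB hν i).lt_of_ne fun h0 => hi.not_ge ?_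
  have hbm := mul_pos hp.beta_pos hp.m_pos
  have h1 := hp.one_sub_pos
  have hv : W (i + 1) = W 1 + ν / (β * m) := by
    have h2 : W (i + 1) - W 1 = ν / (β * m) := by
      rw [eq_div_iff hbm.ne', mul_comm]
      rw [advantage] at h0
      linarith
    linarith
  have hc : (1 - β) * W (i + 1) ≤ c (i + 1) := by
    have h2 := hW (i + 1)
    have h3 := mul_le_mul_of_nonneg_left (never_value_le hp hW hB hν (i + 1 + 1))
      hp.beta_pos.le
    rw [← hv] at h3
    linarith
  have hb1 : β ^ (i : ℕ) ≤ 1 := pow_le_one₀ hp.beta_pos.le hp.beta_lt.le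
  have h3 : (1 - β ^ (i : ℕ)) * W (i + 1) ≤
      (1 - β ^ (i : ℕ)) * ((1 - β * q) * tailCost β c q (i + 1)) / (1 - β) := by
    rw [mul_div_assoc]
    refine mul_le_mul_of_nonneg_left ?_ (sub_nonneg.2 hb1)
    rw [le_div_iff₀ h1, mul_comm]
    exact hc.trans (hp.le_tail _)
  have h4 : ν = β * m * (W (i + 1) - W 1) := by
    rw [advantage] at h0
    linarith
  rw [never_index_eq hp hW i, h4]
  exact mul_le_mul_of_nonneg_left (by linarith) hbm.le

end NeverTransmit

end Index

end AoI

end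

noncomputable section

namespace AoI

/-! ### Verification of threshold policies -/

section Verification

variable {lam mu : I} {β q ν : ℝ} {c : ℕ+ → ℝ}

/-- In each slot the age fails to reset with probability at least `q`, whatever the policy; the cost
after a reset is simply dropped. -/
lemma tailCost_le_meanCost (hp : Params lam mu β q c) (π : StationaryPolicy) (i : ℕ+)
    (hi : arrivalMean lam (costMetric lam mu β c π.toPolicy) i ≠ ⊤) :
    tailCost β c q i ≤ meanCost lam mu β c π.toPolicy i := by
  refine tailCost_le_of_step hp.beta_pos.le hp.q_nonneg hp.c_nonneg hp.summable (fun i => ?_) i hi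
  refine le_of_le_of_eq ?_ (arrivalMean_costMetric hp.beta_pos.le c π i).symm
  rw [ENNReal.ofReal_mul hp.beta_pos.le, mul_assoc]
  refine add_le_add le_rfl (mul_le_mul_right ?_ _)
  refine le_trans (mul_le_mul_left (ENNReal.ofReal_le_ofReal ?_) _) le_add_self
  rw [hp.q_eq]
  linarith [mul_le_of_le_one_right hp.p_pos.le (π i).2.2]

/-- The evaluation equation of a stationary policy in terms of the advantage. -/
lemma meanObjective_eq_sub (hp : Params lam mu β q c) (ν : ℝ) (π : StationaryPolicy) (i : ℕ+)
    (h : arrivalMean lam (costMetric lam mu β c π.toPolicy) i ≠ ⊤) :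
    meanObjective lam mu β c ν π.toPolicy i =
      c i + β * meanObjective lam mu β c ν π.toPolicy (i + 1) -
        lam * π i * advantage mu β ν (meanObjective lam mu β c ν π.toPolicy) i := by
  rw [meanObjective_eq hp.beta_pos hp.beta_lt hp.c_nonneg ν π i h, advantage]
  ring

/-- The objective as a real number; it is meaningful when the cost metric is finite. -/
def realObjective (lam mu : I) (β : ℝ) (c : ℕ+ → ℝ) (ν : ℝ) (π : Policy) (y : State) : ℝ :=
  (costMetric lam mu β c π y).toReal + ν * (workMetric lam mu β π y).toReal

lemma realObjective_false (hp : Params lam mu β q c) (ν : ℝ) (π : Policy) (i : ℕ+)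
    (h : costMetric lam mu β c π (false, i) ≠ ⊤) :
    realObjective lam mu β c ν π (false, i) =
      c i + β * meanObjective lam mu β c ν π.shift (i + 1) := by
  rw [realObjective, (toReal_costMetric_false hp.beta_pos hp.c_nonneg π i h).2,
    toReal_workMetric_false hp.beta_pos, meanObjective]
  ring

lemma realObjective_true (hp : Params lam mu β q c) (ν : ℝ) (π : Policy) (i : ℕ+)
    (h : costMetric lam mu β c π (true, i) ≠ ⊤) :
    realObjective lam mu β c ν π (true, i) =
      c i + π 0 i * ν + β * (π 0 i * mu * meanObjective lam mu β c ν π.shift 1 +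
        (1 - π 0 i * mu) * meanObjective lam mu β c ν π.shift (i + 1)) := by
  rw [realObjective, (toReal_costMetric_true hp.beta_pos hp.c_nonneg π i h).2.2,
    toReal_workMetric_true hp.beta_pos hp.beta_lt, meanObjective, meanObjective]
  ring

lemma meanObjective_eq_mean (hp : Params lam mu β q c) (ν : ℝ) (π : Policy)
    (h : ∀ y, costMetric lam mu β c π y ≠ ⊤) (i : ℕ+) :
    meanObjective lam mu β c ν π i = lam * realObjective lam mu β c ν π (true, i) +
      (1 - lam) * realObjective lam mu β c ν π (false, i) := by
  have hmean : ∀ u : State → ℝ≥0∞, (∀ y, u y ≠ ⊤) →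
      (arrivalMean lam u i).toReal =
        lam * (u (true, i)).toReal + (1 - lam) * (u (false, i)).toReal := by
    intro u hu
    rw [arrivalMean, ENNReal.toReal_add (ENNReal.mul_ne_top ENNReal.ofReal_ne_top (hu _))
      (ENNReal.mul_ne_top ENNReal.ofReal_ne_top (hu _)), toReal_ofReal_mul lam.2.1,
      toReal_ofReal_mul (sub_nonneg.2 lam.2.2)]
  rw [meanObjective, meanCost, meanWork, hmean _ h,
    hmean _ fun y => workMetric_ne_top hp.beta_pos.le hp.beta_lt π y, realObjective,
    realObjective]
  ring

lemma abs_work_le (hp : Params lam mu β q c) (ν : ℝ) (π : Policy) (i : ℕ+) :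
    |ν * meanWork lam mu β π i| ≤ |ν| * (1 - β)⁻¹ := by
  rw [abs_mul, abs_of_nonneg (meanWork_nonneg _ _)]
  exact mul_le_mul_of_nonneg_left (meanWork_le hp.beta_pos hp.beta_lt _ _) (abs_nonneg _)

/-- A function below its one-step evaluation under `π`, and below the tail cost up to a
constant, is a lower bound for the mean objective of `π`. -/
lemma le_meanObjective (hp : Params lam mu β q c) (π : StationaryPolicy) {W : ℕ+ → ℝ} {K : ℝ}
    (hW : ∀ i, W i ≤ c i + β * W (i + 1) - lam * π i * advantage mu β ν W i)
    (hK : ∀ i, W i ≤ tailCost β c q i + K) (i : ℕ+)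
    (hi : arrivalMean lam (costMetric lam mu β c π.toPolicy) i ≠ ⊤) :
    W i ≤ meanObjective lam mu β c ν π.toPolicy i := by
  have hβ := hp.beta_pos
  -- The initial gap is at most `K` from the cost part plus `|ν| / (1 - β)` from the work part; each
  -- slot multiplies it by `β`. The induction visits only ages of finite mean cost.
  have h : ∀ n : ℕ, ∀ i, arrivalMean lam (costMetric lam mu β c π.toPolicy) i ≠ ⊤ →
      W i ≤ meanObjective lam mu β c ν π.toPolicy i + β ^ n * (K + |ν| * (1 - β)⁻¹) := by
    intro n
    induction n with
    | zero =>
      intro i hi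
      have h1 := tailCost_le_meanCost hp π i hi
      have h3 := (abs_le.1 (abs_work_le hp ν π.toPolicy i)).1
      have h4 := hK i
      rw [meanObjective, pow_zero, one_mul]
      linarith
    | succ n ih =>
      intro i hi
      obtain ⟨f1, f2, -⟩ := meanCost_eq hβ hp.c_nonneg π i hi
      have hx0 : 0 ≤ (lam : ℝ) * mu * π i := mul_nonneg hp.p_pos.le (π i).2.1
      have hx1 : (lam : ℝ) * mu * π i ≤ 1 := mul_le_one₀ hp.p_le (π i).2.1 (π i).2.2
      have h1 : (lam : ℝ) * mu * π i * W 1 ≤ lam * mu * π i *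
          (meanObjective lam mu β c ν π.toPolicy 1 + β ^ n * (K + |ν| * (1 - β)⁻¹)) := by
        rcases hx0.eq_or_lt with h0 | h0
        · rw [← h0, zero_mul, zero_mul]
        · exact mul_le_mul_of_nonneg_left (ih 1 (f1 h0)) hx0
      have h2 : (1 - (lam : ℝ) * mu * π i) * W (i + 1) ≤ (1 - lam * mu * π i) *
          (meanObjective lam mu β c ν π.toPolicy (i + 1) + β ^ n * (K + |ν| * (1 - β)⁻¹)) := by
        rcases hx1.eq_or_lt with h0 | h0
        · rw [h0, sub_self, zero_mul, zero_mul]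
        · exact mul_le_mul_of_nonneg_left (ih (i + 1) (f2 h0)) (sub_nonneg.2 hx1)
      have h3 := mul_le_mul_of_nonneg_left (add_le_add h1 h2) hβ.le
      refine (hW i).trans ?_
      rw [meanObjective_eq hβ hp.beta_lt hp.c_nonneg ν π i hi, advantage, pow_succ]
      linarith
  have ht : Filter.Tendsto (fun n : ℕ => meanObjective lam mu β c ν π.toPolicy i +
      β ^ n * (K + |ν| * (1 - β)⁻¹)) Filter.atTop
      (nhds (meanObjective lam mu β c ν π.toPolicy i + 0 * (K + |ν| * (1 - β)⁻¹))) :=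
    ((tendsto_pow_atTop_nhds_zero_of_lt_one hβ.le hp.beta_lt).mul_const _).const_add _
  rw [zero_mul, add_zero] at ht
  exact ge_of_tendsto' ht fun n => h n i hi

lemma threshold_of_lt {k : ℕ∞} {i : ℕ+} (h : k < ((i : ℕ) : ℕ∞)) : threshold k i = 1 := by
  simp [threshold, sure, h]

lemma threshold_of_le {k : ℕ∞} {i : ℕ+} (h : ((i : ℕ) : ℕ∞) ≤ k) : threshold k i = 0 := by
  simp [threshold, sure, not_lt.2 h]

/-- The `k`-threshold policy has finite cost and takes the action favoured by its own
advantage function in every state. -/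
structure Certified (lam mu : I) (β : ℝ) (c : ℕ+ → ℝ) (q ν : ℝ) (k : ℕ∞) : Prop where
  finite : ∀ y, costMetric lam mu β c (threshold k).toPolicy y ≠ ⊤
  bound : ∃ K, ∀ i, meanObjective lam mu β c ν (threshold k).toPolicy i ≤ tailCost β c q i + K
  nonneg : ∀ i : ℕ+, k < ((i : ℕ) : ℕ∞) →
    0 ≤ advantage mu β ν (meanObjective lam mu β c ν (threshold k).toPolicy) i
  nonpos : ∀ i : ℕ+, ((i : ℕ) : ℕ∞) ≤ k →
    advantage mu β ν (meanObjective lam mu β c ν (threshold k).toPolicy) i ≤ 0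

/-! ### Optimality of certified policies, and what it forces on other optimal policies -/

namespace Certified

variable {k : ℕ∞}

/-- The threshold action maximises `x * A i` over `x ∈ [0, 1]`: no one-step deviation improves on
it. -/
lemma mul_advantage_le (h : Certified lam mu β c q ν k) (x : I) (i : ℕ+) :
    (x : ℝ) * advantage mu β ν (meanObjective lam mu β c ν (threshold k).toPolicy) i ≤
      threshold k i * advantage mu β ν (meanObjective lam mu β c ν (threshold k).toPolicy) i := by
  rcases lt_or_ge k ((i : ℕ) : ℕ∞) with hi | hi
  · rw [threshold_of_lt hi]
    exact mul_le_mul_of_nonneg_right x.2.2 (h.nonneg i hi)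
  · rw [threshold_of_le hi, Set.Icc.coe_zero, zero_mul]
    exact mul_nonpos_of_nonneg_of_nonpos x.2.1 (h.nonpos i hi)

lemma mean_finite (h : Certified lam mu β c q ν k) (i : ℕ+) :
    arrivalMean lam (costMetric lam mu β c (threshold k).toPolicy) i ≠ ⊤ :=
  arrivalMean_ne_top (h.finite _) (h.finite _)

lemma meanObjective_le (hp : Params lam mu β q c) (h : Certified lam mu β c q ν k)
    (π : StationaryPolicy) (i : ℕ+)
    (hi : arrivalMean lam (costMetric lam mu β c π.toPolicy) i ≠ ⊤) :
    meanObjective lam mu β c ν (threshold k).toPolicy i ≤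
      meanObjective lam mu β c ν π.toPolicy i := by
  obtain ⟨K, hK⟩ := h.bound
  refine le_meanObjective hp π (fun i => ?_) hK i hi
  have e := meanObjective_eq_sub hp ν (threshold k) i (h.mean_finite i)
  have := mul_le_mul_of_nonneg_left (h.mul_advantage_le (π i) i) lam.2.1
  linarith

lemma isOptimal (hp : Params lam mu β q c) (h : Certified lam mu β c q ν k) :
    IsOptimal lam mu β c ν (threshold k) := by
  rintro π ⟨b, i⟩
  by_cases hπ : costMetric lam mu β c π.toPolicy (b, i) = ⊤
  · rw [objective_eq_top hp.beta_pos hp.beta_lt ν _ _ hπ]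
    exact le_top
  rw [objective_eq_coe hp.beta_pos hp.beta_lt ν _ _ (h.finite _),
    objective_eq_coe hp.beta_pos hp.beta_lt ν _ _ hπ, EReal.coe_le_coe_iff]
  change realObjective lam mu β c ν _ _ ≤ realObjective lam mu β c ν _ _
  cases b with
  | false =>
    rw [realObjective_false hp ν _ i (h.finite _), realObjective_false hp ν _ i hπ]
    have h1 := (toReal_costMetric_false hp.beta_pos hp.c_nonneg _ i hπ).1
    exact add_le_add le_rfl
      (mul_le_mul_of_nonneg_left (h.meanObjective_le hp π _ h1) hp.beta_pos.le)
  | true =>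
    rw [realObjective_true hp ν _ i (h.finite _), realObjective_true hp ν _ i hπ]
    obtain ⟨f1, f2, -⟩ := toReal_costMetric_true hp.beta_pos hp.c_nonneg _ i hπ
    obtain ⟨hx0, hx1⟩ := mul_mem_unit (π i) mu
    change (0 : ℝ) < (π i : ℝ) * mu → _ at f1
    change (π i : ℝ) * mu < 1 → _ at f2
    have h1 : (π i : ℝ) * mu * meanObjective lam mu β c ν (threshold k).toPolicy 1 ≤
        π i * mu * meanObjective lam mu β c ν π.toPolicy 1 := by
      rcases hx0.eq_or_lt with h0 | h0
      · rw [← h0, zero_mul, zero_mul]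
      · exact mul_le_mul_of_nonneg_left (h.meanObjective_le hp π _ (f1 h0)) hx0
    have h2 : (1 - (π i : ℝ) * mu) *
        meanObjective lam mu β c ν (threshold k).toPolicy (i + 1) ≤
        (1 - π i * mu) * meanObjective lam mu β c ν π.toPolicy (i + 1) := by
      rcases hx1.eq_or_lt with h0 | h0
      · rw [h0, sub_self, zero_mul, zero_mul]
      · exact mul_le_mul_of_nonneg_left (h.meanObjective_le hp π _ (f2 h0)) (sub_nonneg.2 hx1)
    have h3 := mul_le_mul_of_nonneg_left (add_le_add h1 h2) hp.beta_pos.le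
    have h4 := h.mul_advantage_le (π i) i
    rw [advantage] at h4
    change c i + (threshold k i : ℝ) * ν + β * ((threshold k i : ℝ) * mu *
      meanObjective lam mu β c ν (threshold k).toPolicy 1 + (1 - (threshold k i : ℝ) * mu) *
      meanObjective lam mu β c ν (threshold k).toPolicy (i + 1)) ≤
      c i + (π i : ℝ) * ν + β * ((π i : ℝ) * mu * meanObjective lam mu β c ν π.toPolicy 1 +
      (1 - (π i : ℝ) * mu) * meanObjective lam mu β c ν π.toPolicy (i + 1))
    linarith

/-- Every optimal policy is indifferent wherever it deviates from a certified one. -/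
lemma sub_mul_advantage_eq_zero (hp : Params lam mu β q c) (h : Certified lam mu β c q ν k)
    {π : StationaryPolicy} (hπ : IsOptimal lam mu β c ν π) (j : ℕ+) :
    ((threshold k j : ℝ) - π j) *
      advantage mu β ν (meanObjective lam mu β c ν (threshold k).toPolicy) j = 0 := by
  have heq : ∀ y, objective lam mu β c ν π.toPolicy y =
      objective lam mu β c ν (threshold k).toPolicy y := fun y =>
    le_antisymm (hπ _ y) (h.isOptimal hp _ y)
  have hfin : ∀ y, costMetric lam mu β c π.toPolicy y ≠ ⊤ := by
    intro y hy
    have e := heq y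
    rw [objective_eq_top hp.beta_pos hp.beta_lt ν _ _ hy,
      objective_eq_coe hp.beta_pos hp.beta_lt ν _ _ (h.finite y)] at e
    exact EReal.coe_ne_top _ e.symm
  have hreal : ∀ y, realObjective lam mu β c ν π.toPolicy y =
      realObjective lam mu β c ν (threshold k).toPolicy y := by
    intro y
    have e := heq y
    rw [objective_eq_coe hp.beta_pos hp.beta_lt ν _ _ (hfin y),
      objective_eq_coe hp.beta_pos hp.beta_lt ν _ _ (h.finite y), EReal.coe_eq_coe_iff] at e
    exact e
  -- With equal continuation values, the two evaluations at `(true, j)` differ only through the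
  -- first action.
  have hmean : meanObjective lam mu β c ν π.toPolicy =
      meanObjective lam mu β c ν (threshold k).toPolicy := by
    funext i
    rw [meanObjective_eq_mean hp ν _ hfin, meanObjective_eq_mean hp ν _ h.finite, hreal, hreal]
  have e := hreal (true, j)
  rw [realObjective_true hp ν _ j (hfin _), realObjective_true hp ν _ j (h.finite _)] at e
  change c j + (π j : ℝ) * ν + β * ((π j : ℝ) * mu * meanObjective lam mu β c ν π.toPolicy 1 +
      (1 - (π j : ℝ) * mu) * meanObjective lam mu β c ν π.toPolicy (j + 1)) =
    c j + (threshold k j : ℝ) * ν + β * ((threshold k j : ℝ) * mu *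
      meanObjective lam mu β c ν (threshold k).toPolicy 1 + (1 - (threshold k j : ℝ) * mu) *
      meanObjective lam mu β c ν (threshold k).toPolicy (j + 1)) at e
  rw [hmean] at e
  rw [advantage]
  linarith

lemma advantage_nonneg_of_action (hp : Params lam mu β q c) (h : Certified lam mu β c q ν k)
    {j : ℕ+} (ha : IsOptimalAction lam mu β c ν j true) :
    0 ≤ advantage mu β ν (meanObjective lam mu β c ν (threshold k).toPolicy) j := by
  obtain ⟨π, hπ, hj⟩ := ha
  rcases lt_or_ge k ((j : ℕ) : ℕ∞) with hk | hk
  · exact h.nonneg j hk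
  · have e := h.sub_mul_advantage_eq_zero hp hπ j
    rw [hj, threshold_of_le hk] at e
    simp [sure] at e
    exact e.ge

lemma advantage_nonpos_of_action (hp : Params lam mu β q c) (h : Certified lam mu β c q ν k)
    {j : ℕ+} (ha : IsOptimalAction lam mu β c ν j false) :
    advantage mu β ν (meanObjective lam mu β c ν (threshold k).toPolicy) j ≤ 0 := by
  obtain ⟨π, hπ, hj⟩ := ha
  rcases lt_or_ge k ((j : ℕ) : ℕ∞) with hk | hk
  · have e := h.sub_mul_advantage_eq_zero hp hπ j
    rw [hj, threshold_of_lt hk] at e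
    simp [sure] at e
    exact e.le
  · exact h.nonpos j hk

end Certified

end Verification

end AoI

end

noncomputable section

namespace AoI

/-! ### Values of threshold policies -/

section Threshold

variable {lam mu : I} {β q ν : ℝ} {c : ℕ+ → ℝ}

/-- A real supersolution of the averaged evaluation equation bounds the cost metric. -/
lemma arrivalMean_costMetric_le (hp : Params lam mu β q c) (π : StationaryPolicy) {U : ℕ+ → ℝ}
    (hU0 : ∀ i, 0 ≤ U i)
    (hU : ∀ i, c i + β * (lam * mu * π i * U 1 + (1 - lam * mu * π i) * U (i + 1)) ≤ U i) :
    (∀ y, costMetric lam mu β c π.toPolicy y ≠ ⊤) ∧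
      ∀ i, arrivalMean lam (costMetric lam mu β c π.toPolicy) i ≤ ENNReal.ofReal (U i) := by
  have hβ := hp.beta_pos.le
  -- One evaluation step lifts `U` from ages to states; the arrival mean of `u` is again below `U`,
  -- so `u` is a supersolution on states.
  let u : State → ℝ≥0∞ := fun y => ENNReal.ofReal (c y.2) + ENNReal.ofReal β *
    if y.1 then ENNReal.ofReal (π y.2 * mu) * ENNReal.ofReal (U 1) +
      ENNReal.ofReal (1 - π y.2 * mu) * ENNReal.ofReal (U (y.2 + 1))
    else ENNReal.ofReal (U (y.2 + 1))
  have hmean : ∀ i, arrivalMean lam u i ≤ ENNReal.ofReal (U i) := by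
    intro i
    have hx0 : 0 ≤ (lam : ℝ) * mu * π i := mul_nonneg hp.p_pos.le (π i).2.1
    have hx1 : 0 ≤ 1 - (lam : ℝ) * mu * π i :=
      sub_nonneg.2 (mul_le_one₀ hp.p_le (π i).2.1 (π i).2.2)
    have e : arrivalMean lam u i = ENNReal.ofReal (c i) + ENNReal.ofReal β *
        (ENNReal.ofReal (lam * mu * π i) * ENNReal.ofReal (U 1) +
          ENNReal.ofReal (1 - lam * mu * π i) * ENNReal.ofReal (U (i + 1))) := by
      refine (arrivalMean_step lam mu (π i) _ _ _ _ _).trans ?_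
      rw [← add_mul, ofReal_add_ofReal_one_sub, one_mul]
    rw [e, ← ENNReal.ofReal_mul hx0, ← ENNReal.ofReal_mul hx1,
      ← ENNReal.ofReal_add (mul_nonneg hx0 (hU0 _)) (mul_nonneg hx1 (hU0 _)),
      ← ENNReal.ofReal_mul hβ, ← ENNReal.ofReal_add (hp.c_nonneg i) (mul_nonneg hβ
        (add_nonneg (mul_nonneg hx0 (hU0 _)) (mul_nonneg hx1 (hU0 _))))]
    exact ENNReal.ofReal_le_ofReal (hU i)
  have hle : ∀ y, costMetric lam mu β c π.toPolicy y ≤ u y := by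
    intro y
    rw [costMetric_eq_metric lam mu hβ]
    refine metric_le_of_supersolution lam mu _ _ π u (fun y => ?_) y
    obtain ⟨b, i⟩ := y
    cases b with
    | false =>
      rw [expect_slotLaw_false, expect_nextState_passive]
      exact add_le_add le_rfl (mul_le_mul_right (hmean _) _)
    | true =>
      rw [expect_slotLaw_true, expect_nextState_passive, expect_nextState_active, mix_actions,
        ← add_mul, ofReal_add_ofReal_one_sub, one_mul]
      exact add_le_add le_rfl (mul_le_mul_right (add_le_add (mul_le_mul_right (hmean _) _)
        (mul_le_mul_right (hmean _) _)) _)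
  refine ⟨fun y => ((hle y).trans_lt ?_).ne, fun i => le_trans ?_ (hmean i)⟩
  · have hfin : ∀ a b : ℝ, ENNReal.ofReal a * ENNReal.ofReal b ≠ ⊤ := fun a b =>
      ENNReal.mul_ne_top ENNReal.ofReal_ne_top ENNReal.ofReal_ne_top
    refine lt_top_iff_ne_top.2 (ENNReal.add_ne_top.2 ⟨ENNReal.ofReal_ne_top,
      ENNReal.mul_ne_top ENNReal.ofReal_ne_top ?_⟩)
    split_ifs
    · exact ENNReal.add_ne_top.2 ⟨hfin _ _, hfin _ _⟩
    · exact ENNReal.ofReal_ne_top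
  · exact add_le_add (mul_le_mul_right (hle _) _) (mul_le_mul_right (hle _) _)

lemma meanCost_le (hp : Params lam mu β q c) (π : StationaryPolicy) {U : ℕ+ → ℝ}
    (hU0 : ∀ i, 0 ≤ U i)
    (hU : ∀ i, c i + β * (lam * mu * π i * U 1 + (1 - lam * mu * π i) * U (i + 1)) ≤ U i)
    (i : ℕ+) : meanCost lam mu β c π.toPolicy i ≤ U i :=
  ENNReal.toReal_le_of_le_ofReal (hU0 i) ((arrivalMean_costMetric_le hp π hU0 hU).2 i)

/-- A bound for the mean cost of the `k`-threshold policy. -/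
def thresholdBound (β q : ℝ) (c : ℕ+ → ℝ) (k : ℕ) (i : ℕ+) : ℝ :=
  tailCost β c q (max i k.succPNat) + tailCost β c q k.succPNat / (1 - β)

lemma thresholdBound_nonneg (hp : Params lam mu β q c) (k : ℕ) (i : ℕ+) :
    0 ≤ thresholdBound β q c k i :=
  add_nonneg (hp.tail_nonneg _) (div_nonneg (hp.tail_nonneg _) hp.one_sub_pos.le)

lemma lt_coe_iff {k : ℕ} {i : ℕ+} : (k : ℕ∞) < ((i : ℕ) : ℕ∞) ↔ k < (i : ℕ) := Nat.cast_lt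

/-- The summand `T / (1 - β)`, with `T` the tail cost at `k + 1`, loses exactly `T` per slot to
discounting. This pays for the reset term beyond the threshold and for `c i` below it. -/
lemma thresholdBound_step (hp : Params lam mu β q c) (k : ℕ) (i : ℕ+) :
    c i + β * (lam * mu * threshold k i * thresholdBound β q c k 1 +
      (1 - lam * mu * threshold k i) * thresholdBound β q c k (i + 1)) ≤
        thresholdBound β q c k i := by
  have h1 := hp.one_sub_pos
  have hD : (1 - β) * (tailCost β c q k.succPNat / (1 - β)) = tailCost β c q k.succPNat :=
    mul_div_cancel₀ _ h1.ne'
  have hT := hp.tail_nonneg k.succPNat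
  have hmax1 : max 1 k.succPNat = k.succPNat := max_eq_right one_le
  simp only [thresholdBound, hmax1]
  generalize tailCost β c q k.succPNat / (1 - β) = D at *
  rcases lt_or_ge k (i : ℕ) with hi | hi
  · have hki : k.succPNat ≤ i := hi
    rw [threshold_of_lt (lt_coe_iff.2 hi), Set.Icc.coe_one, max_eq_left hki,
      max_eq_left (hki.trans (PNat.lt_add_right i 1).le), hp.tail_eq i, hp.q_eq]
    have h2 : β * (lam * mu) * tailCost β c (1 - lam * mu) k.succPNat ≤
        tailCost β c (1 - lam * mu) k.succPNat := by
      rw [← hp.q_eq]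
      exact mul_le_of_le_one_left hT (mul_le_one₀ hp.beta_lt.le hp.p_pos.le hp.p_le)
    rw [hp.q_eq] at hD
    linarith
  · have hki : i + 1 ≤ k.succPNat := Nat.succ_le_succ hi
    have hki' : i ≤ k.succPNat := (PNat.lt_add_right i 1).le.trans hki
    rw [threshold_of_le (by exact_mod_cast hi), Set.Icc.coe_zero, max_eq_right hki,
      max_eq_right hki']
    have h2 := hp.le_tail i
    have h3 := hp.tail_mono hki'
    have h4 := hp.tail_nonneg i
    have h5 := mul_nonneg hp.bq_nonneg h4
    have h6 := mul_nonneg h1.le hT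
    linarith

lemma costMetric_threshold_ne_top (hp : Params lam mu β q c) (k : ℕ) (y : State) :
    costMetric lam mu β c (threshold k).toPolicy y ≠ ⊤ :=
  (arrivalMean_costMetric_le hp _ (thresholdBound_nonneg hp k) (thresholdBound_step hp k)).1 y

/-- The constant by which the mean objective of a threshold policy exceeds the tail cost. -/
def tailGap (l m β q ν : ℝ) (W : ℕ+ → ℝ) : ℝ := (l * ν + β * (l * m) * W 1) / (1 - β * q)

/-- Beyond `k`, the error `e` in the tail form satisfies `e i = β q e (i + 1)`. It is bounded, since
mean cost and tail cost differ by a bounded amount even when both are unbounded, and so it vanishes.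
-/
lemma thresholdValue (hp : Params lam mu β q c) (ν : ℝ) (k : ℕ) :
    ThresholdValue lam mu β q ν c (meanObjective lam mu β c ν (threshold k).toPolicy) k
      (tailGap lam mu β q ν (meanObjective lam mu β c ν (threshold k).toPolicy)) := by
  have hfin : ∀ i, arrivalMean lam (costMetric lam mu β c (threshold k).toPolicy) i ≠ ⊤ :=
    fun i => arrivalMean_ne_top (costMetric_threshold_ne_top hp k _)
      (costMetric_threshold_ne_top hp k _)
  have hbelow : ∀ i : ℕ+, (i : ℕ) ≤ k → meanObjective lam mu β c ν (threshold k).toPolicy i =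
      c i + β * meanObjective lam mu β c ν (threshold k).toPolicy (i + 1) := by
    intro i hi
    have e := meanObjective_eq_sub hp ν (threshold k) i (hfin i)
    rw [threshold_of_le (by exact_mod_cast hi), Set.Icc.coe_zero, mul_zero, zero_mul,
      sub_zero] at e
    exact e
  have habove : ∀ i : ℕ+, k < (i : ℕ) → meanObjective lam mu β c ν (threshold k).toPolicy i =
      c i + β * meanObjective lam mu β c ν (threshold k).toPolicy (i + 1) -
        lam * advantage mu β ν (meanObjective lam mu β c ν (threshold k).toPolicy) i := by
    intro i hi
    have e := meanObjective_eq_sub hp ν (threshold k) i (hfin i)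
    rw [threshold_of_lt (lt_coe_iff.2 hi), Set.Icc.coe_one, mul_one] at e
    exact e
  refine ⟨hbelow, habove, fun i hi => ?_⟩
  have hlow := fun i => tailCost_le_meanCost hp (threshold k) i (hfin i)
  have hup := meanCost_le hp _ (thresholdBound_nonneg hp k) (thresholdBound_step hp k)
  have hwork := abs_work_le hp ν (threshold k).toPolicy
  have hg : (1 - β * q) *
      tailGap lam mu β q ν (meanObjective lam mu β c ν (threshold k).toPolicy) =
      lam * ν + β * (lam * mu) * meanObjective lam mu β c ν (threshold k).toPolicy 1 :=
    mul_div_cancel₀ _ (sub_pos.2 hp.bq_lt).ne'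
  generalize tailGap lam mu β q ν (meanObjective lam mu β c ν (threshold k).toPolicy) = g at *
  have h0 := eq_zero_of_eq_mul_succ (k := k) (B := tailCost β c q k.succPNat / (1 - β) +
      |ν| * (1 - β)⁻¹ + |g|) (e := fun i =>
      meanObjective lam mu β c ν (threshold k).toPolicy i - tailCost β c q i - g)
    hp.bq_nonneg hp.bq_lt (fun i hi => by
      have e := habove i hi
      have e2 := hp.tail_eq i
      have e3 := hp.q_eq
      rw [advantage] at e
      change _ = β * q * (meanObjective lam mu β c ν (threshold k).toPolicy (i + 1) -
        tailCost β c q (i + 1) - g)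
      linear_combination e - e2 - hg + β *
        meanObjective lam mu β c ν (threshold k).toPolicy (i + 1) * -e3)
    (fun i hi => by
      have h1 := hlow i
      have h2 := hup i
      have h3 := abs_le.1 (hwork i)
      have h4 := neg_abs_le g
      have h5 := le_abs_self g
      have h6 := div_nonneg (hp.tail_nonneg k.succPNat) hp.one_sub_pos.le
      rw [thresholdBound, max_eq_left (show k.succPNat ≤ i from hi)] at h2
      rw [meanObjective]
      exact abs_le.2 ⟨by linarith, by linarith⟩) i hi
  linarith

/-- Threshold policies between the index values are certified. -/
lemma certified_threshold (hp : Params lam mu β q c) {k : ℕ}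
    (hk : ∀ i : ℕ+, (i : ℕ) = k → indexFormula mu β q c i ≤ ν)
    (hk' : ν ≤ indexFormula mu β q c k.succPNat) : Certified lam mu β c q ν k where
  finite := costMetric_threshold_ne_top hp k
  bound := by
    have h := thresholdValue hp ν k
    have hup := meanCost_le hp _ (thresholdBound_nonneg hp k) (thresholdBound_step hp k)
    refine ⟨tailCost β c q k.succPNat + tailCost β c q k.succPNat / (1 - β) +
      |ν| * (1 - β)⁻¹, fun i => ?_⟩
    have h1 := hup i
    have h2 := (abs_le.1 (abs_work_le hp ν (threshold k).toPolicy i)).2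
    have h3 : tailCost β c q (max i k.succPNat) ≤
        tailCost β c q i + tailCost β c q k.succPNat := by
      rcases max_choice i k.succPNat with e | e
      · rw [e]; linarith [hp.tail_nonneg k.succPNat]
      · rw [e]; linarith [hp.tail_nonneg i]
    rw [thresholdBound] at h1
    rw [meanObjective]
    linarith
  nonneg i hi := (thresholdValue hp ν k).advantage_nonneg hp hk hk' i (lt_coe_iff.1 hi)
  nonpos i hi := (thresholdValue hp ν k).advantage_nonpos hp hk i (by exact_mod_cast hi)

/-- The costs are bounded by `cost_le_of_index_le`, so a constant is a supersolution. -/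
lemma never_finite (hp : Params lam mu β q c) (hν : ∀ i, indexFormula mu β q c i ≤ ν) :
    (∀ y, costMetric lam mu β c (threshold ⊤).toPolicy y ≠ ⊤) ∧
      ∀ i, meanCost lam mu β c (threshold ⊤).toPolicy i ≤ (c 1 + ν / (β * mu)) / (1 - β) := by
  have h1 := hp.one_sub_pos
  have hB := hp.cost_le_of_index_le hν
  have h0 : 0 ≤ (c 1 + ν / (β * mu)) / (1 - β) :=
    div_nonneg ((hp.c_nonneg 1).trans (hB 1)) h1.le
  have hU : ∀ i : ℕ+, c i + β * (lam * mu * threshold ⊤ i * ((c 1 + ν / (β * mu)) / (1 - β)) +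
      (1 - lam * mu * threshold ⊤ i) * ((c 1 + ν / (β * mu)) / (1 - β))) ≤
      (c 1 + ν / (β * mu)) / (1 - β) := by
    intro i
    have h2 : (1 - β) * ((c 1 + ν / (β * mu)) / (1 - β)) = c 1 + ν / (β * mu) :=
      mul_div_cancel₀ _ h1.ne'
    have h3 := hB i
    linarith
  exact ⟨(arrivalMean_costMetric_le hp _ (fun _ => h0) hU).1,
    fun i => meanCost_le hp _ (U := fun _ => _) (fun _ => h0) hU i⟩

lemma never_eq (hp : Params lam mu β q c) (hν : ∀ i, indexFormula mu β q c i ≤ ν) (i : ℕ+) :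
    meanObjective lam mu β c ν (threshold ⊤).toPolicy i =
      c i + β * meanObjective lam mu β c ν (threshold ⊤).toPolicy (i + 1) := by
  have hfin := (never_finite hp hν).1
  have e := meanObjective_eq_sub hp ν (threshold ⊤) i (arrivalMean_ne_top (hfin _) (hfin _))
  rw [threshold_of_le le_top, Set.Icc.coe_zero, mul_zero, zero_mul, sub_zero] at e
  exact e

lemma never_abs_le (hp : Params lam mu β q c) (hν : ∀ i, indexFormula mu β q c i ≤ ν) (i : ℕ+) :
    |meanObjective lam mu β c ν (threshold ⊤).toPolicy i| ≤
      (c 1 + ν / (β * mu)) / (1 - β) + |ν| * (1 - β)⁻¹ := by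
  refine (abs_add_le _ _).trans (add_le_add ?_ (abs_work_le hp ν _ i))
  rw [meanCost, abs_of_nonneg ENNReal.toReal_nonneg]
  exact (never_finite hp hν).2 i

/-- Never transmitting is certified if no index exceeds the charge. -/
lemma certified_never (hp : Params lam mu β q c) (hν : ∀ i, indexFormula mu β q c i ≤ ν) :
    Certified lam mu β c q ν ⊤ where
  finite := (never_finite hp hν).1
  bound := ⟨_, fun i => ((le_abs_self _).trans (never_abs_le hp hν i)).trans
    (le_add_of_nonneg_left (hp.tail_nonneg i))⟩
  nonneg _ hi := absurd hi not_top_lt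
  nonpos i _ := never_advantage_nonpos hp (never_eq hp hν) (never_abs_le hp hν) hν i

end Threshold

/-! ### The marginal metrics -/

section Marginal

variable {lam mu : I} {β q : ℝ} {c : ℕ+ → ℝ}

lemma costMetric_firstThen_ne_top (hp : Params lam mu β q c) (a : Bool) (k : ℕ) (i : ℕ+) :
    costMetric lam mu β c (firstThen a k) (true, i) ≠ ⊤ := by
  have hfin : ∀ i, arrivalMean lam (costMetric lam mu β c (firstThen a k).shift) i ≠ ⊤ :=
    fun i => arrivalMean_ne_top (costMetric_threshold_ne_top hp k _)
      (costMetric_threshold_ne_top hp k _)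
  rw [costMetric_true hp.beta_pos.le]
  exact ENNReal.add_ne_top.2 ⟨ENNReal.ofReal_ne_top, ENNReal.mul_ne_top ENNReal.ofReal_ne_top
    (ENNReal.add_ne_top.2 ⟨ENNReal.mul_ne_top ENNReal.ofReal_ne_top (hfin _),
      ENNReal.mul_ne_top ENNReal.ofReal_ne_top (hfin _)⟩)⟩

/-- Both policies continue with the `k`-policy, so only the transition made with probability `mu`
survives the subtraction. -/
lemma marginalCost_eq (hp : Params lam mu β q c) (k : ℕ) (i : ℕ+) :
    marginalCost lam mu β c k i =
      β * mu * (meanCost lam mu β c (threshold k).toPolicy (i + 1) -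
        meanCost lam mu β c (threshold k).toPolicy 1) := by
  have e0 := (toReal_costMetric_true hp.beta_pos hp.c_nonneg _ i
    (costMetric_firstThen_ne_top hp false k i)).2.2
  have e1 := (toReal_costMetric_true hp.beta_pos hp.c_nonneg _ i
    (costMetric_firstThen_ne_top hp true k i)).2.2
  rw [marginalCost, e0, e1]
  simp only [firstThen, sure, if_true, Bool.false_eq_true, if_false, Set.Icc.coe_zero,
    Set.Icc.coe_one]
  change c i + β * (_ * meanCost lam mu β c (threshold k).toPolicy 1 +
      _ * meanCost lam mu β c (threshold k).toPolicy (i + 1)) -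
    (c i + β * (_ * meanCost lam mu β c (threshold k).toPolicy 1 +
      _ * meanCost lam mu β c (threshold k).toPolicy (i + 1))) = _
  ring

lemma marginalWork_eq (hp : Params lam mu β q c) (k : ℕ) (i : ℕ+) :
    marginalWork lam mu β k i =
      1 - β * mu * (meanWork lam mu β (threshold k).toPolicy (i + 1) -
        meanWork lam mu β (threshold k).toPolicy 1) := by
  rw [marginalWork, toReal_workMetric_true hp.beta_pos hp.beta_lt,
    toReal_workMetric_true hp.beta_pos hp.beta_lt]
  simp only [firstThen, sure, if_true, Bool.false_eq_true, if_false, Set.Icc.coe_zero,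
    Set.Icc.coe_one]
  change 1 + β * (_ * meanWork lam mu β (threshold k).toPolicy 1 +
      _ * meanWork lam mu β (threshold k).toPolicy (i + 1)) -
    (0 + β * (_ * meanWork lam mu β (threshold k).toPolicy 1 +
      _ * meanWork lam mu β (threshold k).toPolicy (i + 1))) = _
  ring

lemma advantage_eq_marginal (hp : Params lam mu β q c) (ν : ℝ) (k : ℕ) (i : ℕ+) :
    advantage mu β ν (meanObjective lam mu β c ν (threshold k).toPolicy) i =
      marginalCost lam mu β c k i - ν * marginalWork lam mu β k i := by
  rw [marginalCost_eq hp, marginalWork_eq hp, advantage, meanObjective, meanObjective]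
  ring

/-- `advantage_at` at `ν = 0` gives marginal cost times the weight, and its difference from `ν = 1`
gives marginal work times the same weight; the weight cancels in the quotient. -/
lemma mpIndex_eq (hp : Params lam mu β q c) (i : ℕ+) :
    mpIndex lam mu β c i = indexFormula mu β q c i := by
  have e0 := (thresholdValue hp 0 i).advantage_at hp i rfl
  have e1 := (thresholdValue hp 1 i).advantage_at hp i rfl
  rw [advantage_eq_marginal hp] at e0 e1
  have hw := ThresholdValue.weight_pos hp i
  have h1 := hp.one_sub_pos
  generalize 1 - β * q - β * β ^ (i : ℕ) * (lam * mu) = w at *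
  have e2 : marginalWork lam mu β i i * w = 1 - β := by linear_combination e0 - e1
  have hg : 0 < marginalWork lam mu β i i := pos_of_mul_pos_left (e2 ▸ h1) hw.le
  rw [mpIndex, div_eq_iff hg.ne']
  refine mul_right_cancel₀ hw.ne' ?_
  linear_combination e0 - indexFormula mu β q c i * e2

/-- Mean work is a constant `Γ` beyond the threshold, at most `Γ` everywhere, and `β ^ k Γ` at age
`1`. It remains to show `mu (Γ - β ^ k Γ) < 1`. -/
lemma lt_marginalWork (hp : Params lam mu β q c) (k : ℕ) (i : ℕ+) :
    1 - β < marginalWork lam mu β k i := by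
  have hβ := hp.beta_pos
  set G := meanWork lam mu β (threshold k).toPolicy with hG
  obtain ⟨Γ, hΓ⟩ : ∃ Γ, Γ = G k.succPNat := ⟨_, rfl⟩
  have hbelow : ∀ i : ℕ+, (i : ℕ) ≤ k → G i = β * G (i + 1) := by
    intro i hi
    have e := meanWork_eq (lam := lam) (mu := mu) hβ hp.beta_lt (threshold k) i
    rw [threshold_of_le (by exact_mod_cast hi), Set.Icc.coe_zero] at e
    rw [hG]
    linear_combination e
  have habove : ∀ i : ℕ+, k < (i : ℕ) →
      G i = lam + β * (lam * mu * G 1 + (1 - lam * mu) * G (i + 1)) := by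
    intro i hi
    have e := meanWork_eq (lam := lam) (mu := mu) hβ hp.beta_lt (threshold k) i
    rw [threshold_of_lt (lt_coe_iff.2 hi), Set.Icc.coe_one, mul_one, mul_one] at e
    exact e
  -- The objectives for charges `1` and `0` differ by the mean work, and the tail cost cancels in
  -- the difference.
  have hconst : ∀ i : ℕ+, k < (i : ℕ) → G i = Γ := by
    have hdiff : ∀ i : ℕ+, k < (i : ℕ) →
        G i = tailGap lam mu β q 1 (meanObjective lam mu β c 1 (threshold k).toPolicy) -
          tailGap lam mu β q 0 (meanObjective lam mu β c 0 (threshold k).toPolicy) := by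
      intro i hi
      have e0 := (thresholdValue hp 0 k).tail i hi
      have e1 := (thresholdValue hp 1 k).tail i hi
      rw [meanObjective] at e0 e1
      linear_combination e1 - e0
    intro i hi
    rw [hΓ, hdiff i hi, hdiff k.succPNat (Nat.lt_succ_self k)]
  have hΓ0 : 0 ≤ Γ := hΓ ▸ meanWork_nonneg _ _
  have hle : ∀ i, G i ≤ Γ := by
    intro i
    have h := nonneg_of_mul_succ_le (k := 0) (e := fun i => Γ - G i) (B := (1 - β)⁻¹)
      hβ.le hp.beta_lt (fun i _ => by
        rcases lt_or_ge k (i : ℕ) with hi | hi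
        · rw [hconst i hi, hconst (i + 1) (hi.trans (PNat.lt_add_right i 1))]
          simp
        · have h1 := hbelow i hi
          have h2 := mul_le_of_le_one_left hΓ0 hp.beta_lt.le
          linarith) (fun i _ => by
        have h1 := meanWork_le (lam := lam) (mu := mu) hβ hp.beta_lt (threshold k).toPolicy i
        change _ ≤ Γ - G i
        linarith) i i.pos
    exact sub_nonneg.1 h
  have hone : G 1 = β ^ k * Γ := by
    have e := mul_one_eq_sum_add (β := β) (c := fun _ => 0) (W := G) k.succPNat fun j hj => by
      rw [zero_add]
      exact hbelow j (Nat.lt_succ_iff.1 hj)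
    simp only [mul_zero, Finset.sum_const_zero, zero_add, sub_zero, ← hΓ, Nat.succPNat_coe,
      pow_succ] at e
    refine mul_left_cancel₀ hβ.ne' ?_
    linear_combination e
  have hΓeq : Γ = lam + β * (lam * mu * (β ^ k * Γ) + (1 - lam * mu) * Γ) := by
    have e := habove k.succPNat (Nat.lt_succ_self k)
    rw [← hΓ, hone, hconst (k.succPNat + 1)
      ((Nat.lt_succ_self k).trans (PNat.lt_add_right k.succPNat 1))] at e
    exact e
  rw [marginalWork_eq hp, ← hG, hone]
  have hb0 : 0 < β ^ k := pow_pos hβ k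
  have hb1 : β ^ k ≤ 1 := pow_le_one₀ hβ.le hp.beta_lt.le
  have hmu := mul_le_mul_of_nonneg_left (hle (i + 1)) (mul_nonneg hβ.le hp.m_pos.le)
  generalize β ^ k = b at *
  have hp0 := hp.p_pos
  have hpb : (lam : ℝ) * mu * (1 - b) < 1 :=
    (mul_le_of_le_one_left (sub_nonneg.2 hb1) hp.p_le).trans_lt (by linarith)
  have hw0 : 0 < 1 - β + β * (lam * mu) * (1 - b) :=
    add_pos_of_pos_of_nonneg hp.one_sub_pos
      (mul_nonneg (mul_nonneg hβ.le hp0.le) (sub_nonneg.2 hb1))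
  -- With `p = lam * mu`, multiplying by `w = 1 - β + β p (1 - b)` turns the left side into `p (1 -
  -- b)`, and `w - p (1 - b) = (1 - β) (1 - p (1 - b))` is positive.
  have hkey : mu * (Γ - b * Γ) < 1 := by
    refine lt_of_mul_lt_mul_right ?_ hw0.le
    have e : mu * (Γ - b * Γ) * (1 - β + β * (lam * mu) * (1 - b)) =
        lam * mu * (1 - b) := by linear_combination (mu * (1 - b)) * hΓeq
    rw [e, one_mul]
    have := mul_pos hp.one_sub_pos (sub_pos.2 hpb)
    linarith
  have := mul_lt_mul_of_pos_left hkey hβ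
  linarith

end Marginal

/-! ### Indexability -/

section Whittle

variable {lam mu : I} {β q ν : ℝ} {c : ℕ+ → ℝ}

/-- The threshold below the first state in which `P` holds. -/
lemma exists_threshold {P : ℕ+ → Prop} {j : ℕ+} (hj : P j) :
    ∃ k : ℕ, k < (j : ℕ) ∧ (∀ i : ℕ+, (i : ℕ) = k → ¬P i) ∧ P k.succPNat := by
  classical
  have hex : ∃ n : ℕ, P n.succPNat := ⟨j.natPred, by rwa [PNat.succPNat_natPred]⟩
  refine ⟨Nat.find hex, ?_, fun i hi hPi => ?_, Nat.find_spec hex⟩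
  · have h1 : Nat.find hex ≤ j.natPred := Nat.find_min' hex (by rwa [PNat.succPNat_natPred])
    exact h1.trans_lt (by have := PNat.natPred_add_one j; omega)
  · refine Nat.find_min hex (m := i.natPred) ?_ (by rwa [PNat.succPNat_natPred])
    have := PNat.natPred_add_one i
    omega

lemma exists_isOptimal_threshold (hp : Params lam mu β q c) (ν : ℝ) :
    ∃ k : ℕ∞, IsOptimal lam mu β c ν (threshold k) := by
  by_cases h : ∃ j, ν ≤ indexFormula mu β q c j
  · obtain ⟨j, hj⟩ := h
    obtain ⟨k, -, h1, h2⟩ := exists_threshold (P := fun j => ν ≤ indexFormula mu β q c j) hj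
    exact ⟨k, (certified_threshold hp (fun i hi => (not_le.1 (h1 i hi)).le) h2).isOptimal hp⟩
  · simp only [not_exists, not_le] at h
    exact ⟨⊤, (certified_never hp fun i => (h i).le).isOptimal hp⟩

/-- Stopping at the first age with `ν ≤` index gives a certified policy that transmits at every tie,
while the index at `k` is strictly below `ν`, so the advantage is strictly negative up to `k`. -/
lemma isOptimalAction_true_iff (hp : Params lam mu β q c) (j : ℕ+) (ν : ℝ) :
    IsOptimalAction lam mu β c ν j true ↔ ν ≤ indexFormula mu β q c j := by
  refine ⟨fun ha => ?_, fun hj => ?_⟩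
  · by_contra! hlt
    by_cases h : ∃ j, ν ≤ indexFormula mu β q c j
    · obtain ⟨j', hj'⟩ := h
      obtain ⟨k, -, h1, h2⟩ := exists_threshold (P := fun j => ν ≤ indexFormula mu β q c j) hj'
      simp only [not_le] at h1
      have hk : (j : ℕ) ≤ k := Nat.lt_succ_iff.1 (hp.index_mono.reflect_lt (hlt.trans_le h2))
      exact ((certified_threshold hp (fun i hi => (h1 i hi).le) h2).advantage_nonneg_of_action
        hp ha).not_gt ((thresholdValue hp ν k).advantage_neg hp h1 j hk)
    · simp only [not_exists, not_le] at h
      have hν := fun i => (h i).le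
      exact ((certified_never hp hν).advantage_nonneg_of_action hp ha).not_gt
        (never_advantage_neg hp (never_eq hp hν) (never_abs_le hp hν) hν j hlt)
  · obtain ⟨k, hk, h1, h2⟩ := exists_threshold (P := fun j => ν ≤ indexFormula mu β q c j) hj
    exact ⟨threshold k,
      (certified_threshold hp (fun i hi => (not_le.1 (h1 i hi)).le) h2).isOptimal hp,
      threshold_of_lt (lt_coe_iff.2 hk)⟩

/-- Here the threshold precedes the first age with `ν <` index, so ties are resolved by not
transmitting and the advantage beyond `k` is strictly positive. -/
lemma isOptimalAction_false_iff (hp : Params lam mu β q c) (j : ℕ+) (ν : ℝ) :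
    IsOptimalAction lam mu β c ν j false ↔ indexFormula mu β q c j ≤ ν := by
  refine ⟨fun ha => ?_, fun hj => ?_⟩
  · by_contra! hlt
    obtain ⟨k, hk, h1, h2⟩ := exists_threshold (P := fun j => ν < indexFormula mu β q c j) hlt
    simp only [not_lt] at h1
    exact ((certified_threshold hp h1 h2.le).advantage_nonpos_of_action hp ha).not_gt
      ((thresholdValue hp ν k).advantage_pos hp h1 h2 j hk)
  · by_cases h : ∃ j, ν < indexFormula mu β q c j
    · obtain ⟨j', hj'⟩ := h
      obtain ⟨k, -, h1, h2⟩ := exists_threshold (P := fun j => ν < indexFormula mu β q c j) hj'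
      simp only [not_lt] at h1
      have hk : (j : ℕ) ≤ k := Nat.lt_succ_iff.1 (hp.index_mono.reflect_lt (hj.trans_lt h2))
      exact ⟨threshold k, (certified_threshold hp h1 h2.le).isOptimal hp,
        threshold_of_le (by exact_mod_cast hk)⟩
    · simp only [not_exists, not_lt] at h
      exact ⟨threshold ⊤, (certified_never hp h).isOptimal hp, threshold_of_le le_top⟩

lemma isWhittleIndex_mpIndex (hp : Params lam mu β q c) :
    IsWhittleIndex lam mu β c (mpIndex lam mu β c) := fun j ν => by
  rw [mpIndex_eq hp]
  exact ⟨isOptimalAction_true_iff hp j ν, isOptimalAction_false_iff hp j ν⟩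

end Whittle

end AoI

end

theorem mainTheorem1 (lam mu : unitInterval) (hlam : 0 < lam) (hmu : 0 < mu)
    (β : ℝ) (hβ0 : 0 < β) (hβ1 : β < 1)
    (q : ℝ) (hq : q = 1 - lam * mu)
    (c : ℕ+ → ℝ) (hc0 : ∀ i, 0 ≤ c i) (hc : Monotone c)
    (hsum : Summable fun i : ℕ+ => c i * q ^ (i : ℕ)) :
    (∀ (a : Bool) (k : ℕ) (i : ℕ+),
      AoI.costMetric lam mu β c (AoI.firstThen a k) (true, i) ≠ ⊤ ∧
      AoI.workMetric lam mu β (AoI.firstThen a k) (true, i) ≠ ⊤) ∧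
    (∀ (k : ℕ) (i : ℕ+), 1 - β < AoI.marginalWork lam mu β k i) ∧
    Monotone (AoI.mpIndex lam mu β c) ∧
    AoI.ThresholdIndexable lam mu β c ∧
    AoI.IsWhittleIndex lam mu β c (AoI.mpIndex lam mu β c) ∧
    (∀ i : ℕ+, Summable fun j : ℕ => (β * q) ^ j * c ⟨i + j, Nat.add_pos_left i.pos j⟩) ∧
    ∀ i : ℕ+, AoI.mpIndex lam mu β c i =
      mu * (β * (1 - β ^ (i : ℕ)) * (1 - β * q) / (1 - β) * AoI.tailCost β c q (i + 1) -
        ∑ j ∈ Finset.Icc 1 i, β ^ (j : ℕ) * c j) := by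
  have hp : AoI.Params lam mu β q c :=
    { l_pos := hlam
      l_le := lam.2.2
      m_pos := hmu
      m_le := mu.2.2
      beta_pos := hβ0
      beta_lt := hβ1
      q_eq := hq
      c_nonneg := hc0
      c_mono := hc
      summable := AoI.summable_tail hβ0.le hβ1.le
        (by linarith [(AoI.mul_mem_unit lam mu).2]) hc0 hsum }
  have hW := AoI.isWhittleIndex_mpIndex hp
  refine ⟨fun a k i => ⟨AoI.costMetric_firstThen_ne_top hp a k i,
    AoI.workMetric_ne_top hβ0.le hβ1 _ _⟩, AoI.lt_marginalWork hp, ?_,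
    ⟨⟨_, hW⟩, AoI.exists_isOptimal_threshold hp⟩, hW, hp.summable, AoI.mpIndex_eq hp⟩
  rw [funext (AoI.mpIndex_eq hp)]
  exact hp.index_mono
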